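/- Let $K$ be a field. All vector spaces are $\mathbb{Z}$-graded over $K$, signs follow the Koszul rule, and differentials have degree $-1$. For a graded vector space $V$ let $T^c(V)=\bigoplus_{n\ge 0}V^{\otimes n}$ be the tensor coalgebra, graded by total degree, with the deconcatenation comultiplication $\Delta$, counit $\varepsilon$, unit $1$, inclusion $\iota_1:V\to T^c(V)$ and projection $p_1:T^c(V)\to V$. A (shifted) $B_\infty$ algebra is a graded vector space $A$ with a degree $-1$ coderivation $d$ of $T^c(A)$, $d^2=0$, $d(1)=0$, and a degree $0$ coalgebra map $\mu:T^c(A)\otimes T^c(A)\to T^c(A)$ which is associative with unit $1$, such that $d$ is a derivation of $\mu$. Its operations are $m_n=p_1d|_{A^{\otimes n}}$ and $m_{i,j}=p_1\mu|_{A^{\otimes i}\otimes A^{\otimes j}}$; a homomorphism of $B_\infty$ algebras is a degree $0$ linear map commuting with all $m_n$ and all $m_{i,j}$. A 2-associative differential algebra is a unital differential graded algebra $(V,\bullet,1,\partial)$ with a second associative multiplication $\circ$ of degree $0$ with the same unit $1$, and no further compatibility; homomorphisms are degree $0$ linear maps preserving $\bullet,\circ,1,\partial$. Let $\tau^\circ:T^c(V)\to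 T^c(V)$ be the unital coalgebra map with $p_1\tau^\circ(v_1\otimes\cdots\otimes v_n)=v_1\circ\cdots\circ v_n$ for $n\ge 1$, and let $\tilde p_1:T^c(V)\to V$ be $p_1$ on $\ker\varepsilon$ with $\tilde p_1(1)=1$. The underlying $B_\infty$ algebra of $V$ is $V$ with the unique $B_\infty$ structure $(d,\mu)$ such that $p_1\tau^\circ\mu(x\otimes y)=p_1\tau^\circ(x)\bullet p_1\tau^\circ(y)$ and $p_1\tau^\circ d(x)=\partial\, p_1\tau^\circ(x)$ for all $x,y\in\ker\varepsilon$. This is a functor from 2-associative differential algebras to $B_\infty$ algebras, which is the identity on underlying linear maps. Let $T^c$ be the functor from $B_\infty$ algebras to 2-associative differential algebras sending $A$, with structure $(d,\mu)$, to $(T^c(A),\partial,\bullet,\circ)$, where $\partial=d$, $\bullet=\mu$, and $\circ$ is concatenation of tensors, and sending $f$ to $\bigoplus_n f^{\otimes n}$. For a $B_\infty$ algebra $A$ with operations $\overline m_{i,j},\overline m_n$, let $\alpha:A\to F(A)$ be the free 2-associative differential algebra on the graded vector space $A$, and let $m_{i,j},m_n$ be the operations of the underlying $B_\infty$ algebra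 of $F(A)$. Let $U(A)=F(A)/I$, where $I$ is the two-sided ideal (for both multiplications, homogeneous and stable under $\partial$) generated by all elements $$\alpha(\overline m_{i,j}(a\otimes b))-m_{i,j}(\alpha^{\otimes (i+j)}(a\otimes b)),\qquad \alpha(\overline m_n(c))-m_n(\alpha^{\otimes n}(c)),$$ with $a\in A^{\otimes i}$, $b\in A^{\otimes j}$, $c\in A^{\otimes n}$. Then the class map $\eta^U_A:A\to U(A)$, $a\mapsto[\alpha(a)]$, is a homomorphism of $B_\infty$ algebras, and $U$ is a functor, with $U(f)$ the homomorphism satisfying $U(f)\,\eta^U_A=\eta^U_B\,f$ for $f:A\to B$. **Proposition.** The functor $T^c$ is left adjoint to the underlying $B_\infty$ algebra functor, by an adjunction whose unit is $\iota_1:A\to T^c(A)$ for every $B_\infty$ algebra $A$ and whose counit is $\tilde p_1\tau^\circ:T^c(V)\to V$ for every 2-associative differential algebra $V$. Moreover there is a natural isomorphism $U\cong T^c$ of functors whose component $U(A)\to T^c(A)$ sends $\eta^U_A(a)$ to $\iota_1(a)$ for every $a\in A$. -/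

import Mathlib

open DirectSum TensorProduct CategoryTheory

universe u

set_option linter.unusedSectionVars false

noncomputable section

namespace BInfinity

section TensorCoalgebra

variable (K : Type*) [Field K]

/-- The Koszul sign `(-1) ^ n`. -/
def sg (n : ℤ) : K := (-1) ^ n

lemma sg_zero : sg K 0 = 1 := by simp [sg]
lemma sg_add (m n : ℤ) : sg K (m + n) = sg K m * sg K n :=
  zpow_add₀ (by simp) m n
lemma sg_mul_self (n : ℤ) : sg K n * sg K n = 1 := by
  rw [← sg_add, ← two_mul, sg, zpow_mul]; simp
lemma sg_sub_one (n : ℤ) : sg K (n - 1) = - sg K n := by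
  rw [sub_eq_add_neg, sg_add]; simp [sg]

variable {K}
variable {V W : Type*} [AddCommGroup V] [Module K V] [AddCommGroup W] [Module K W]

/-- The linear map which is multiplication by `(-1) ^ (n * |v|)` on homogeneous `v`. -/
def signTwist (deg : ℤ → Submodule K V) [Decomposition deg] (n : ℤ) : V →ₗ[K] V :=
  toModule K ℤ V (fun p => sg K (n * p) • (deg p).subtype) ∘ₗ
    (decomposeLinearEquiv deg).toLinearMap

lemma decomposeLinearEquiv_of_mem (deg : ℤ → Submodule K V) [Decomposition deg] {p : ℤ} {x : V}
    (hx : x ∈ deg p) : decomposeLinearEquiv deg x = lof K ℤ (fun i => deg i) p ⟨x, hx⟩ := by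
  rw [decomposeLinearEquiv_apply, decompose_of_mem deg hx, lof_eq_of]

lemma signTwist_of_mem (deg : ℤ → Submodule K V) [Decomposition deg] (n : ℤ) {p : ℤ} {x : V}
    (hx : x ∈ deg p) : signTwist deg n x = sg K (n * p) • x := by
  simp [signTwist, decomposeLinearEquiv_of_mem deg hx, toModule_lof]

/-- The symmetry `v ⊗ w ↦ (-1) ^ (|v| |w|) w ⊗ v` of the tensor product of graded spaces. -/
def koszulSwap (deg : ℤ → Submodule K V) [Decomposition deg] (deg' : ℤ → Submodule K W)
    [Decomposition deg'] : V ⊗[K] W →ₗ[K] W ⊗[K] V :=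
  TensorProduct.lift (toModule K ℤ (W →ₗ[K] W ⊗[K] V)
    (fun p => ((TensorProduct.mk K W V).flip.compl₂ (signTwist deg' p)) ∘ₗ (deg p).subtype) ∘ₗ
      (decomposeLinearEquiv deg).toLinearMap)

lemma koszulSwap_tmul (deg : ℤ → Submodule K V) [Decomposition deg] (deg' : ℤ → Submodule K W)
    [Decomposition deg'] {p q : ℤ} {x : V} {y : W} (hx : x ∈ deg p) (hy : y ∈ deg' q) :
    koszulSwap deg deg' (x ⊗ₜ y) = sg K (p * q) • (y ⊗ₜ[K] x) := by
  simp [koszulSwap, decomposeLinearEquiv_of_mem deg hx, toModule_lof,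
    signTwist_of_mem deg' p hy, smul_tmul']

variable (K V)

/-- The tensor (co)algebra on `V`; its ring structure is concatenation of tensors. -/
abbrev T := TensorAlgebra K V

/-- The inclusion `ι₁` of the generators. -/
abbrev gen : V →ₗ[K] T K V := TensorAlgebra.ι K

/-- The projection `p₁` of the tensor coalgebra onto `V`. -/
abbrev proj1 : T K V →ₗ[K] V := TensorAlgebra.ιInv

/-- The counit `p₀` of the tensor coalgebra. -/
abbrev counit : T K V →ₐ[K] K := TensorAlgebra.algebraMapInv

variable {K V}

/-- The algebra map of tensor algebras induced by a linear map. -/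
def tmap (f : V →ₗ[K] W) : T K V →ₐ[K] T K W := TensorAlgebra.lift K (gen K W ∘ₗ f)

@[simp] lemma tmap_gen (f : V →ₗ[K] W) (v : V) : tmap f (gen K V v) = gen K W (f v) := by
  simp [tmap]

variable (K V)

/-- One step of the recursion `Δ (v x) = (v ⊗ 1) Δ x + 1 ⊗ v x`, acting on pairs `(x, Δ x)`. -/
def deconcStep : V →ₗ[K] Module.End K (T K V × (T K V ⊗[K] T K V)) where
  toFun v := LinearMap.prod (LinearMap.mulLeft K (gen K V v) ∘ₗ LinearMap.fst K _ _)
    ((LinearMap.mulLeft K (gen K V v)).rTensor (T K V) ∘ₗ LinearMap.snd K _ _ +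
      TensorProduct.mk K _ _ 1 ∘ₗ LinearMap.mulLeft K (gen K V v) ∘ₗ LinearMap.fst K _ _)
  map_add' v w := by
    have h : LinearMap.mulLeft K (gen K V (v + w)) =
        LinearMap.mulLeft K (gen K V v) + LinearMap.mulLeft K (gen K V w) := by
      ext; simp [add_mul]
    apply LinearMap.ext
    intro x
    rw [h]
    simp only [LinearMap.rTensor_add]
    ext
    · simp
    · simp [tmul_add]
      abel
  map_smul' c v := by
    have h : LinearMap.mulLeft K (gen K V (c • v)) = c • LinearMap.mulLeft K (gen K V v) := by
      ext; simp
    apply LinearMap.ext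
    intro x
    rw [h]
    simp only [LinearMap.rTensor_smul]
    ext <;> simp

lemma deconcStep_apply (v : V) (p : T K V × (T K V ⊗[K] T K V)) :
    deconcStep K V v p = (gen K V v * p.1,
      (LinearMap.mulLeft K (gen K V v)).rTensor (T K V) p.2 + 1 ⊗ₜ[K] (gen K V v * p.1)) := rfl

/-- Deconcatenation `v₁ ⋯ vₖ ↦ ∑ i, v₁ ⋯ vᵢ ⊗ vᵢ₊₁ ⋯ vₖ`, the comultiplication of the tensor
coalgebra; it is the linear map with `Δ 1 = 1 ⊗ 1` and `Δ (v x) = (v ⊗ 1) Δ x + 1 ⊗ v x`. -/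
def deconc : T K V →ₗ[K] T K V ⊗[K] T K V :=
  LinearMap.snd K _ _ ∘ₗ LinearMap.applyₗ (1, 1 ⊗ₜ[K] 1) ∘ₗ
    (TensorAlgebra.lift K (deconcStep K V)).toLinearMap

variable {K V}

@[simp] lemma deconc_one : deconc K V 1 = 1 ⊗ₜ 1 := by
  simp [deconc]

lemma T_induction {P : T K V → Prop} (one : P 1) (add : ∀ x y, P x → P y → P (x + y))
    (smul : ∀ (c : K) x, P x → P (c • x)) (gen_mul : ∀ v x, P x → P (gen K V v * x)) (x : T K V) :
    P x := by
  suffices h : ∀ x y, P y → P (x * y) by simpa using h x 1 one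
  intro x
  induction x using TensorAlgebra.induction with
  | algebraMap r => intro y hy; simpa [Algebra.algebraMap_eq_smul_one] using smul r y hy
  | ι v => intro y hy; exact gen_mul v y hy
  | add a b ha hb => intro y hy; rw [add_mul]; exact add _ _ (ha y hy) (hb y hy)
  | mul a b ha hb => intro y hy; rw [mul_assoc]; exact ha _ (hb y hy)

lemma deconc_gen_mul (v : V) (x : T K V) :
    deconc K V (gen K V v * x) =
      (LinearMap.mulLeft K (gen K V v)).rTensor (T K V) (deconc K V x) +
        1 ⊗ₜ[K] (gen K V v * x) := by
  have h : ∀ x : T K V, (TensorAlgebra.lift K (deconcStep K V) x (1, 1 ⊗ₜ[K] 1)).1 = x := by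
    intro x
    induction x using T_induction with
    | one => simp
    | add x y hx hy => simp [hx, hy]
    | smul c x hx => simp [hx]
    | gen_mul v x hx =>
      rw [map_mul, TensorAlgebra.lift_ι_apply, Module.End.mul_apply]
      rw [deconcStep_apply, hx]
  conv_lhs => simp only [deconc, LinearMap.comp_apply, AlgHom.toLinearMap_apply, map_mul,
    TensorAlgebra.lift_ι_apply, LinearMap.applyₗ_apply_apply, Module.End.mul_apply]
  rw [deconcStep_apply, h]
  simp [deconc]

@[simp] lemma counit_gen (v : V) : counit K V (gen K V v) = 0 := by
  simp [counit, TensorAlgebra.algebraMapInv]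

@[simp] lemma proj1_gen (v : V) : proj1 K V (gen K V v) = v := TensorAlgebra.ι_leftInverse v

lemma proj1_mul (x y : T K V) :
    proj1 K V (x * y) = counit K V x • proj1 K V y + counit K V y • proj1 K V x := by
  let _ : Module Kᵐᵒᵖ V := Module.compHom _ ((RingHom.id K).fromOpposite mul_comm)
  have : IsCentralScalar K V := ⟨fun r m => rfl⟩
  have h : ∀ x : T K V, (TensorAlgebra.toTrivSqZeroExt x).fst = counit K V x := by
    intro x
    have h1 : (TrivSqZeroExt.fstHom K K V).comp TensorAlgebra.toTrivSqZeroExt = counit K V := by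
      apply TensorAlgebra.hom_ext
      ext v
      simp
    exact DFunLike.congr_fun h1 x
  change (TensorAlgebra.toTrivSqZeroExt (x * y)).snd = _ • (TensorAlgebra.toTrivSqZeroExt y).snd +
    _ • (TensorAlgebra.toTrivSqZeroExt x).snd
  rw [map_mul, TrivSqZeroExt.snd_mul, h, h, op_smul_eq_smul]

@[simp] lemma proj1_one : proj1 K V 1 = 0 := by
  let _ : Module Kᵐᵒᵖ V := Module.compHom _ ((RingHom.id K).fromOpposite mul_comm)
  have : IsCentralScalar K V := ⟨fun r m => rfl⟩
  change (TensorAlgebra.toTrivSqZeroExt (1 : T K V)).snd = 0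
  simp

end TensorCoalgebra

section Words

variable {K : Type*} [Field K] {V W : Type*} [AddCommGroup V] [Module K V]
  [AddCommGroup W] [Module K W] (deg : ℤ → Submodule K V) (deg' : ℤ → Submodule K W)

/-- A homogeneous element of a graded space, with its degree. -/
abbrev Letter := Σ n : ℤ, deg n

variable {deg}

/-- The tensor `v₁ ⋯ vₖ` of homogeneous elements. -/
def word (l : List (Letter deg)) : T K V := (l.map fun a => gen K V (a.2 : V)).prod

/-- The total degree of a tensor of homogeneous elements. -/
def wdeg (l : List (Letter deg)) : ℤ := (l.map Sigma.fst).sum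

@[simp] lemma word_nil : word ([] : List (Letter deg)) = 1 := rfl
@[simp] lemma word_cons (a : Letter deg) (l : List (Letter deg)) :
    word (a :: l) = gen K V (a.2 : V) * word l := by simp [word]
lemma word_append (l m : List (Letter deg)) : word (l ++ m) = word l * word m := by simp [word]
@[simp] lemma wdeg_nil : wdeg ([] : List (Letter deg)) = 0 := rfl
@[simp] lemma wdeg_cons (a : Letter deg) (l : List (Letter deg)) :
    wdeg (a :: l) = a.1 + wdeg l := by simp [wdeg]
lemma wdeg_append (l m : List (Letter deg)) : wdeg (l ++ m) = wdeg l + wdeg m := by simp [wdeg]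

variable (deg)

/-- The grading of the tensor (co)algebra by total degree, `|v₁ ⋯ vₖ| = |v₁| + ⋯ + |vₖ|`. -/
def tdeg (n : ℤ) : Submodule K (T K V) :=
  Submodule.span K {x | ∃ l : List (Letter deg), wdeg l = n ∧ word l = x}

variable {deg}

lemma word_mem (l : List (Letter deg)) : word l ∈ tdeg deg (wdeg l) :=
  Submodule.subset_span ⟨l, rfl, rfl⟩

lemma word_mem_of_eq (l : List (Letter deg)) {n : ℤ} (h : wdeg l = n) : word l ∈ tdeg deg n :=
  h ▸ word_mem l

lemma gen_mem {n : ℤ} {v : V} (h : v ∈ deg n) : gen K V v ∈ tdeg deg n :=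
  Submodule.subset_span ⟨[⟨n, v, h⟩], by simp, by simp⟩

instance tdeg_gradedMonoid : SetLike.GradedMonoid (tdeg deg) where
  one_mem := word_mem_of_eq [] rfl
  mul_mem i j x y hx hy := by
    induction hx, hy using Submodule.span_induction₂ with
    | mem_mem x y hx hy =>
      obtain ⟨l, rfl, rfl⟩ := hx
      obtain ⟨m, rfl, rfl⟩ := hy
      rw [← word_append]
      exact word_mem_of_eq _ (wdeg_append l m)
    | zero_left => simp
    | zero_right => simp
    | add_left x y z _ _ _ h1 h2 => rw [add_mul]; exact add_mem h1 h2
    | add_right x y z _ _ _ h1 h2 => rw [mul_add]; exact add_mem h1 h2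
    | smul_left r x y _ _ h => rw [smul_mul_assoc]; exact Submodule.smul_mem _ _ h
    | smul_right r x y _ _ h => rw [mul_smul_comm]; exact Submodule.smul_mem _ _ h

variable (deg)

/-- The generators, mapped into the external direct sum of the homogeneous components. -/
def tdecompGen [Decomposition deg] : V →ₗ[K] ⨁ n, tdeg deg n :=
  toModule K ℤ _ (fun n => lof K ℤ (fun i => tdeg deg i) n ∘ₗ
    ((gen K V).restrict (fun _ h => gen_mem h) : deg n →ₗ[K] tdeg deg n)) ∘ₗ
      (decomposeLinearEquiv deg).toLinearMap

variable {deg} in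
lemma tdecompGen_of_mem [Decomposition deg] {n : ℤ} {v : V} (h : v ∈ deg n) :
    tdecompGen deg v = DirectSum.of (fun i => tdeg deg i) n ⟨gen K V v, gen_mem h⟩ := by
  simp only [tdecompGen, LinearMap.comp_apply, LinearEquiv.coe_coe,
    decomposeLinearEquiv_of_mem deg h, toModule_lof]
  rfl

/-- The tensor algebra is graded by total degree. -/
instance tdeg_gradedAlgebra [Decomposition deg] : GradedAlgebra (tdeg deg) :=
  GradedAlgebra.ofAlgHom _ (TensorAlgebra.lift K (tdecompGen deg))
    (by
      apply TensorAlgebra.hom_ext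
      apply LinearMap.ext
      intro v
      induction v using Decomposition.inductionOn deg with
      | zero => simp
      | add x y hx hy => rw [map_add, hx, hy, map_add]
      | homogeneous m =>
        simp only [LinearMap.comp_apply, AlgHom.toLinearMap_apply, AlgHom.comp_apply,
          AlgHom.id_apply]
        rw [TensorAlgebra.lift_ι_apply, tdecompGen_of_mem m.2, DirectSum.coeAlgHom_of])
    (by
      have key : ∀ l : List (Letter deg), TensorAlgebra.lift K (tdecompGen deg) (word l) =
          DirectSum.of (fun i => tdeg deg i) (wdeg l) ⟨word l, word_mem l⟩ := by
        intro l
        induction l with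
        | nil => exact map_one _
        | cons a l ih =>
          refine (congrArg _ (word_cons a l)).trans ?_
          rw [map_mul, ih, TensorAlgebra.lift_ι_apply, tdecompGen_of_mem a.2.2,
            DirectSum.of_mul_of]
          exact DirectSum.of_eq_of_gradedMonoid_eq
            (Sigma.subtype_ext (wdeg_cons a l).symm (word_cons a l).symm)
      rintro n ⟨x, hx⟩
      dsimp only
      induction hx using Submodule.span_induction with
      | mem x hx => obtain ⟨l, rfl, rfl⟩ := hx; exact key l
      | zero => rw [map_zero]; exact (map_zero _).symm
      | add x y hx hy h1 h2 => rw [map_add, h1, h2, ← map_add]; rfl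
      | smul c x hx h =>
        rw [map_smul, h, ← lof_eq_of K, ← map_smul]; rfl)

/-- Exchange of the two inner factors, with Koszul sign:
`(a ⊗ x) ⊗ (y ⊗ b) ↦ (-1) ^ (|x| |y|) (a ⊗ y) ⊗ (x ⊗ b)`. -/
def midSwap [Decomposition deg] :
    (T K V ⊗[K] T K V) ⊗[K] (T K V ⊗[K] T K V) →ₗ[K]
      (T K V ⊗[K] T K V) ⊗[K] (T K V ⊗[K] T K V) :=
  (tensorTensorTensorAssoc K (T K V) (T K V) (T K V) (T K V)).symm.toLinearMap ∘ₗ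
    ((koszulSwap (tdeg deg) (tdeg deg)).lTensor (T K V)).rTensor (T K V) ∘ₗ
      (tensorTensorTensorAssoc K (T K V) (T K V) (T K V) (T K V)).toLinearMap

lemma midSwap_tmul [Decomposition deg] {p q : ℤ} {x y : T K V} (hx : x ∈ tdeg deg p)
    (hy : y ∈ tdeg deg q) (a b : T K V) :
    midSwap deg ((a ⊗ₜ x) ⊗ₜ (y ⊗ₜ b)) = sg K (p * q) • ((a ⊗ₜ[K] y) ⊗ₜ[K] (x ⊗ₜ[K] b)) := by
  simp [midSwap, koszulSwap_tmul _ _ hx hy, smul_tmul', tmul_smul]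

end Words

section Splits

variable {α β M N : Type*} [AddCommGroup M] [AddCommGroup N]

/-- The sum of `φ p q` over all the ways of cutting a list as `p ++ q`. -/
def S1 : List α → (List α → List α → M) → M
  | [], φ => φ [] []
  | a :: l, φ => φ [] (a :: l) + S1 l (fun p q => φ (a :: p) q)

lemma S1_congr {l : List α} {φ ψ : List α → List α → M}
    (h : ∀ p q, p ++ q = l → φ p q = ψ p q) : S1 l φ = S1 l ψ := by
  induction l generalizing φ ψ with
  | nil => exact h _ _ rfl
  | cons a l ih =>
    rw [S1, S1, h _ _ rfl, ih]
    intro p q hpq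
    exact h _ _ (by simp [hpq])

lemma S1_add (l : List α) (φ ψ : List α → List α → M) :
    S1 l (fun p q => φ p q + ψ p q) = S1 l φ + S1 l ψ := by
  induction l generalizing φ ψ with
  | nil => rfl
  | cons a l ih => simp only [S1, ih]; abel

lemma S1_map {F : Type*} [FunLike F M N] [AddMonoidHomClass F M N] (g : F) (l : List α)
    (φ : List α → List α → M) : g (S1 l φ) = S1 l (fun p q => g (φ p q)) := by
  induction l generalizing φ with
  | nil => rfl
  | cons a l ih => simp only [S1, map_add, ih]

lemma S1_zero (l : List α) : S1 l (fun _ _ => (0 : M)) = 0 := by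
  induction l with
  | nil => rfl
  | cons a l ih => simp only [S1, ih, add_zero]

lemma S1_neg (l : List α) (φ : List α → List α → M) :
    S1 l (fun p q => - φ p q) = - S1 l φ :=
  (S1_map (-AddMonoidHom.id M) l φ).symm

lemma S1_sub (l : List α) (φ ψ : List α → List α → M) :
    S1 l (fun p q => φ p q - ψ p q) = S1 l φ - S1 l ψ := by
  simp only [sub_eq_add_neg, S1_add, S1_neg]

lemma S1_smul {K : Type*} [Ring K] [Module K M] (c : K) (l : List α)
    (φ : List α → List α → M) : S1 l (fun p q => c • φ p q) = c • S1 l φ :=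
  (S1_map (DistribSMul.toAddMonoidHom M c) l φ).symm

lemma S1_assoc (l : List α) (φ : List α → List α → List α → M) :
    S1 l (fun p q => S1 p (fun a b => φ a b q)) = S1 l (fun p q => S1 q (fun b c => φ p b c)) := by
  induction l generalizing φ with
  | nil => rfl
  | cons a l ih =>
    simp only [S1, S1_add]
    rw [ih (fun p b c => φ (a :: p) b c)]
    abel

lemma S1_comm (l : List α) (m : List β) (φ : List α → List α → List β → List β → M) :
    S1 l (fun p q => S1 m (fun r s => φ p q r s)) =
      S1 m (fun r s => S1 l (fun p q => φ p q r s)) := by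
  induction l generalizing φ with
  | nil => rfl
  | cons a l ih => simp only [S1, S1_add, ih]

lemma S1_left {l : List α} {φ : List α → List α → M} (h : ∀ p q, p ≠ [] → φ p q = 0) :
    S1 l φ = φ [] l := by
  cases l with
  | nil => rfl
  | cons a l =>
    simp only [S1, h _ _ (List.cons_ne_nil _ _), S1_zero, add_zero]

lemma S1_right {l : List α} {φ : List α → List α → M} (h : ∀ p q, q ≠ [] → φ p q = 0) :
    S1 l φ = φ l [] := by
  induction l generalizing φ with
  | nil => rfl
  | cons a l ih => rw [S1, h _ _ (List.cons_ne_nil _ _), ih (fun p q hq => h _ _ hq), zero_add]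

lemma S1_mem {S : Type*} [SetLike S M] [AddSubmonoidClass S M] (P : S) {l : List α}
    {φ : List α → List α → M} (h : ∀ p q, p ++ q = l → φ p q ∈ P) : S1 l φ ∈ P := by
  induction l generalizing φ with
  | nil => exact h _ _ rfl
  | cons a l ih =>
    exact add_mem (h _ _ rfl) (ih fun p q hpq => h _ _ (by simp [hpq]))

end Splits

section Splits2

variable {K : Type*} [Field K] {V : Type*} [AddCommGroup V] [Module K V]
  {deg : ℤ → Submodule K V} {M N : Type*} [AddCommGroup M] [Module K M]
  [AddCommGroup N] [Module K N]

/-- The signed sum over all the ways of cutting two lists. -/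
def S2 (x y : List (Letter deg))
    (φ : List (Letter deg) → List (Letter deg) → List (Letter deg) → List (Letter deg) → M) : M :=
  S1 x fun x1 x2 => S1 y fun y1 y2 => sg K (wdeg x2 * wdeg y1) • φ x1 y1 x2 y2

variable {x y : List (Letter deg)}
  {φ ψ : List (Letter deg) → List (Letter deg) → List (Letter deg) → List (Letter deg) → M}

lemma S2_congr (h : ∀ x1 y1 x2 y2, x1 ++ x2 = x → y1 ++ y2 = y → φ x1 y1 x2 y2 = ψ x1 y1 x2 y2) :
    S2 x y φ = S2 x y ψ :=
  S1_congr fun _ _ hx => S1_congr fun _ _ hy => by rw [h _ _ _ _ hx hy]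

variable (x y φ ψ) in
lemma S2_add : S2 x y (fun a b c d => φ a b c d + ψ a b c d) = S2 x y φ + S2 x y ψ := by
  simp only [S2, smul_add, S1_add]

variable (x y φ ψ) in
lemma S2_sub : S2 x y (fun a b c d => φ a b c d - ψ a b c d) = S2 x y φ - S2 x y ψ := by
  simp only [S2, smul_sub, S1_sub]

variable (x y φ) in
lemma S2_map {F : Type*} [FunLike F M N] [LinearMapClass F K M N] (g : F) : g (S2 x y φ) = S2 x y (fun a b c d => g (φ a b c d)) := by
  rw [S2, S1_map, S2]
  refine S1_congr fun _ _ _ => ?_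
  rw [S1_map]
  refine S1_congr fun _ _ _ => ?_
  rw [map_smul]

lemma S2_mem (P : Submodule K M)
    (h : ∀ x1 y1 x2 y2, x1 ++ x2 = x → y1 ++ y2 = y → φ x1 y1 x2 y2 ∈ P) : S2 x y φ ∈ P :=
  S1_mem _ fun _ _ hx => S1_mem _ fun _ _ hy => P.smul_mem _ (h _ _ _ _ hx hy)

lemma S2_left (h : ∀ a b c d, (a ≠ [] ∨ b ≠ []) → φ a b c d = 0) : S2 x y φ = φ [] [] x y := by
  rw [S2, S1_left, S1_left]
  · simp [sg_zero]
  · intro p q hp; simp [h _ _ _ _ (Or.inr hp)]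
  · intro p q hp; simp [h _ _ _ _ (Or.inl hp), S1_zero]

lemma S2_right (h : ∀ a b c d, (c ≠ [] ∨ d ≠ []) → φ a b c d = 0) : S2 x y φ = φ x y [] [] := by
  rw [S2, S1_right, S1_right]
  · simp [sg_zero]
  · intro p q hp; simp [h _ _ _ _ (Or.inr hp)]
  · intro p q hp; simp [h _ _ _ _ (Or.inl hp), S1_zero]

lemma S2_assoc (x y : List (Letter deg))
    (φ : List (Letter deg) → List (Letter deg) → List (Letter deg) → List (Letter deg) →
      List (Letter deg) → List (Letter deg) → M) :
    S2 x y (fun x1 y1 x2 y2 => S2 x1 y1 (fun a b c d => φ a b c d x2 y2)) =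
      S2 x y (fun x1 y1 x2 y2 => S2 x2 y2 (fun c d e f => φ x1 y1 c d e f)) := by
  have h1 : S2 x y (fun x1 y1 x2 y2 => S2 x1 y1 (fun a b c d => φ a b c d x2 y2)) =
      S1 x fun x1 x2 => S1 x1 fun a c => S1 y fun y1 y2 => S1 y1 fun b d =>
        (sg K (wdeg x2 * (wdeg b + wdeg d)) * sg K (wdeg c * wdeg b)) • φ a b c d x2 y2 := by
    simp only [S2]
    refine S1_congr fun x1 x2 _ => ?_
    rw [S1_comm]
    refine S1_congr fun y1 y2 _ => ?_
    rw [← S1_smul]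
    refine S1_congr fun a c _ => ?_
    rw [← S1_smul]
    refine S1_congr fun b d h => ?_
    rw [← h, wdeg_append, smul_smul]
  have h2 : S2 x y (fun x1 y1 x2 y2 => S2 x2 y2 (fun c d e f => φ x1 y1 c d e f)) =
      S1 x fun a x2 => S1 x2 fun c e => S1 y fun b y2 => S1 y2 fun d f =>
        (sg K ((wdeg c + wdeg e) * wdeg b) * sg K (wdeg e * wdeg d)) • φ a b c d e f := by
    simp only [S2]
    refine S1_congr fun x1 x2 _ => ?_
    rw [S1_comm]
    refine S1_congr fun y1 y2 _ => ?_
    rw [← S1_smul]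
    refine S1_congr fun a c h => ?_
    rw [← S1_smul]
    refine S1_congr fun b d _ => ?_
    rw [← h, wdeg_append, smul_smul]
  rw [h1, h2, S1_assoc x (fun a c e => S1 y fun y1 y2 => S1 y1 fun b d =>
        (sg K (wdeg e * (wdeg b + wdeg d)) * sg K (wdeg c * wdeg b)) • φ a b c d e y2)]
  refine S1_congr fun a x2 _ => S1_congr fun c e _ => ?_
  rw [S1_assoc y (fun b d f =>
        (sg K (wdeg e * (wdeg b + wdeg d)) * sg K (wdeg c * wdeg b)) • φ a b c d e f)]
  refine S1_congr fun b y2 _ => S1_congr fun d f _ => ?_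
  congr 1
  simp only [mul_add, add_mul, sg_add]
  ring

end Splits2

section WordCoalgebra

variable {K : Type*} [Field K] {V : Type*} [AddCommGroup V] [Module K V]
  {deg : ℤ → Submodule K V} {M : Type*} [AddCommGroup M] [Module K M]
  {W : Type*} [AddCommGroup W] [Module K W]

lemma deconc_word (l : List (Letter deg)) :
    deconc K V (word l) = S1 l fun p q => word p ⊗ₜ[K] word q := by
  induction l with
  | nil => simp [S1]
  | cons a l ih =>
    rw [word_cons, deconc_gen_mul, ih, S1_map, S1, add_comm]
    simp

@[simp] lemma counit_word_cons (a : Letter deg) (l : List (Letter deg)) :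
    counit K V (word (a :: l)) = 0 := by
  rw [word_cons, map_mul, counit_gen, zero_mul]

lemma counit_word {l : List (Letter deg)} (h : l ≠ []) : counit K V (word l) = 0 := by
  cases l with
  | nil => exact absurd rfl h
  | cons a l => simp

lemma word_span [Decomposition deg] (x : T K V) :
    x ∈ Submodule.span K (Set.range (word : List (Letter deg) → T K V)) := by
  induction x using T_induction with
  | one => exact Submodule.subset_span ⟨[], rfl⟩
  | add x y hx hy => exact add_mem hx hy
  | smul c x hx => exact Submodule.smul_mem _ c hx
  | gen_mul v x hx =>
    induction hx using Submodule.span_induction with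
    | zero => simp
    | add x y _ _ hx hy => rw [mul_add]; exact add_mem hx hy
    | smul c x _ hx => rw [mul_smul_comm]; exact Submodule.smul_mem _ c hx
    | mem x hx =>
      obtain ⟨l, rfl⟩ := hx
      induction v using Decomposition.inductionOn deg with
      | zero => simp
      | add x y hx hy => rw [map_add, add_mul]; exact add_mem hx hy
      | @homogeneous n m => exact Submodule.subset_span ⟨⟨n, m⟩ :: l, by simp⟩

lemma lin_ext [Decomposition deg] {f g : T K V →ₗ[K] M}
    (h : ∀ l : List (Letter deg), f (word l) = g (word l)) : f = g := by
  apply LinearMap.ext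
  intro x
  induction word_span (deg := deg) x using Submodule.span_induction with
  | zero => simp
  | add x y _ _ hx hy => rw [map_add, map_add, hx, hy]
  | smul c x _ hx => rw [map_smul, map_smul, hx]
  | mem x hx => obtain ⟨l, rfl⟩ := hx; exact h l

lemma lin_ext2 [Decomposition deg] {f g : T K V →ₗ[K] T K V →ₗ[K] M}
    (h : ∀ x y : List (Letter deg), f (word x) (word y) = g (word x) (word y)) : f = g :=
  lin_ext fun x => lin_ext fun y => h x y

variable (K V) in
/-- The elements `a ⊗ 1 + 1 ⊗ b`. -/
def primPart : Submodule K (T K V ⊗[K] T K V) :=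
  LinearMap.range ((TensorProduct.mk K (T K V) (T K V)).flip 1) ⊔
    LinearMap.range (TensorProduct.mk K (T K V) (T K V) 1)

lemma reconstruct (x : T K V) :
    x = algebraMap K _ (counit K V x) + LinearMap.mul' K (T K V)
      ((gen K V ∘ₗ proj1 K V).rTensor (T K V) (deconc K V x)) ∧
    TensorProduct.lid K (T K V) ((counit K V).toLinearMap.rTensor (T K V) (deconc K V x)) = x := by
  induction x using T_induction with
  | one => simp
  | add x y hx hy =>
    refine ⟨?_, ?_⟩
    · conv_lhs => rw [hx.1, hy.1]
      simp only [map_add]; abel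
    · simp only [map_add, hx.2, hy.2]
  | smul c x hx =>
    refine ⟨?_, ?_⟩
    · conv_lhs => rw [hx.1]
      simp only [map_smul, smul_add, smul_eq_mul, map_mul, ← Algebra.smul_def]
    · simp only [map_smul, hx.2]
  | gen_mul v x hx =>
    have h1 : (gen K V ∘ₗ proj1 K V).rTensor (T K V)
        ((LinearMap.mulLeft K (gen K V v)).rTensor (T K V) (deconc K V x)) =
        gen K V v ⊗ₜ (TensorProduct.lid K (T K V)
          ((counit K V).toLinearMap.rTensor (T K V) (deconc K V x))) := by
      induction deconc K V x using TensorProduct.induction_on with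
      | zero => simp
      | add a b ha hb => simp only [map_add, ha, hb, tmul_add]
      | tmul a b => simp [proj1_mul, tmul_smul, smul_tmul']
    have h2 : (counit K V).toLinearMap.rTensor (T K V)
        ((LinearMap.mulLeft K (gen K V v)).rTensor (T K V) (deconc K V x)) = 0 := by
      induction deconc K V x using TensorProduct.induction_on with
      | zero => simp
      | add a b ha hb => simp only [map_add, ha, hb, add_zero]
      | tmul a b => simp
    refine ⟨?_, ?_⟩
    · rw [deconc_gen_mul, map_add, h1, hx.2]; simp
    · rw [deconc_gen_mul, map_add, h2]; simp

lemma eq_gen_of_mem_primPart {t : T K V} (h : deconc K V t ∈ primPart K V)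
    (h0 : counit K V t = 0) : ∃ v, t = gen K V v := by
  obtain ⟨_, ⟨a, rfl⟩, _, ⟨b, rfl⟩, hab⟩ := Submodule.mem_sup.1 h
  refine ⟨proj1 K V a, ?_⟩
  rw [(reconstruct t).1, ← hab, h0]
  simp

lemma term_mem {a b c d : T K V} (h1 : a = 0 ∨ b = 1) (h2 : d = 0 ∨ c = 1) :
    a ⊗ₜ[K] b + c ⊗ₜ[K] d ∈ primPart K V := by
  refine add_mem ?_ ?_
  · rcases h1 with rfl | rfl
    · simp
    · exact Submodule.mem_sup_left ⟨a, rfl⟩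
  · rcases h2 with rfl | rfl
    · simp
    · exact Submodule.mem_sup_right ⟨d, rfl⟩

lemma uniq1 (D F G : List (Letter deg) → T K W) (h0 : ∀ x, counit K W (D x) = 0)
    (hP : ∀ x v, D x = gen K W v → v = 0) (hF : F [] = 1) (hG : G [] = 1)
    (hD : ∀ x, deconc K W (D x) = S1 x fun p q => D p ⊗ₜ[K] F q + G p ⊗ₜ[K] D q) (x) :
    D x = 0 := by
  induction hn : x.length using Nat.strong_induction_on generalizing x with
  | _ n ih =>
    have h : deconc K W (D x) ∈ primPart K W := by
      rw [hD]
      refine S1_mem _ fun p q hpq => ?_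
      have hl := congrArg List.length hpq
      rw [List.length_append] at hl
      refine term_mem ?_ ?_
      · cases q with
        | nil => exact Or.inr hF
        | cons a q => exact Or.inl (ih _ (by simp at hl; omega) p rfl)
      · cases p with
        | nil => exact Or.inr hG
        | cons a p => exact Or.inl (ih _ (by simp at hl; omega) q rfl)
    obtain ⟨v, hv⟩ := eq_gen_of_mem_primPart h (h0 x)
    rw [hv, hP _ _ hv, map_zero]

lemma uniq2 (D F G : List (Letter deg) → List (Letter deg) → T K W)
    (h0 : ∀ x y, counit K W (D x y) = 0)
    (hP : ∀ x y v, D x y = gen K W v → v = 0) (hF : F [] [] = 1) (hG : G [] [] = 1)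
    (hD : ∀ x y, deconc K W (D x y) =
      S2 x y fun a b c d => D a b ⊗ₜ[K] F c d + G a b ⊗ₜ[K] D c d) (x y) :
    D x y = 0 := by
  induction hn : x.length + y.length using Nat.strong_induction_on generalizing x y with
  | _ n ih =>
    have h : deconc K W (D x y) ∈ primPart K W := by
      rw [hD]
      refine S2_mem _ fun x1 y1 x2 y2 hx hy => ?_
      have hl := congrArg List.length hx
      have hm := congrArg List.length hy
      rw [List.length_append] at hl hm
      refine term_mem ?_ ?_
      · by_cases hc : x2 = [] ∧ y2 = []
        · rw [hc.1, hc.2]; exact Or.inr hF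
        · refine Or.inl (ih _ ?_ x1 y1 rfl)
          have := mt (And.imp List.length_eq_zero_iff.1 List.length_eq_zero_iff.1) hc
          omega
      · by_cases hc : x1 = [] ∧ y1 = []
        · rw [hc.1, hc.2]; exact Or.inr hG
        · refine Or.inl (ih _ ?_ x2 y2 rfl)
          have := mt (And.imp List.length_eq_zero_iff.1 List.length_eq_zero_iff.1) hc
          omega
    obtain ⟨v, hv⟩ := eq_gen_of_mem_primPart h (h0 x y)
    rw [hv, hP _ _ _ hv, map_zero]

lemma uniq3 (D F G : List (Letter deg) → List (Letter deg) → List (Letter deg) → T K W)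
    (h0 : ∀ x y z, counit K W (D x y z) = 0)
    (hP : ∀ x y z v, D x y z = gen K W v → v = 0) (hF : F [] [] [] = 1) (hG : G [] [] [] = 1)
    (hD : ∀ x y z, deconc K W (D x y z) =
      S2 x y fun x1 y1 x2 y2 => S1 z fun z1 z2 => sg K ((wdeg x2 + wdeg y2) * wdeg z1) •
        (D x1 y1 z1 ⊗ₜ[K] F x2 y2 z2 + G x1 y1 z1 ⊗ₜ[K] D x2 y2 z2)) (x y z) :
    D x y z = 0 := by
  induction hn : x.length + y.length + z.length using Nat.strong_induction_on
    generalizing x y z with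
  | _ n ih =>
    have h : deconc K W (D x y z) ∈ primPart K W := by
      rw [hD]
      refine S2_mem _ fun x1 y1 x2 y2 hx hy => S1_mem _ fun z1 z2 hz => Submodule.smul_mem _ _ ?_
      have hl := congrArg List.length hx
      have hm := congrArg List.length hy
      have hk := congrArg List.length hz
      rw [List.length_append] at hl hm hk
      refine term_mem ?_ ?_
      · by_cases hc : x2 = [] ∧ y2 = [] ∧ z2 = []
        · rw [hc.1, hc.2.1, hc.2.2]; exact Or.inr hF
        · refine Or.inl (ih _ ?_ x1 y1 z1 rfl)
          have := mt (And.imp List.length_eq_zero_iff.1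
            (And.imp List.length_eq_zero_iff.1 List.length_eq_zero_iff.1)) hc
          omega
      · by_cases hc : x1 = [] ∧ y1 = [] ∧ z1 = []
        · rw [hc.1, hc.2.1, hc.2.2]; exact Or.inr hG
        · refine Or.inl (ih _ ?_ x2 y2 z2 rfl)
          have := mt (And.imp List.length_eq_zero_iff.1
            (And.imp List.length_eq_zero_iff.1 List.length_eq_zero_iff.1)) hc
          omega
    obtain ⟨v, hv⟩ := eq_gen_of_mem_primPart h (h0 x y z)
    rw [hv, hP _ _ _ _ hv, map_zero]

lemma len_lt_left {x y x1 y1 x2 y2 : List (Letter deg)} (hx : x1 ++ x2 = x) (hy : y1 ++ y2 = y)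
    (h : ¬ (x2 = [] ∧ y2 = [])) : x1.length + y1.length < x.length + y.length := by
  have hl := congrArg List.length hx
  have hm := congrArg List.length hy
  rw [List.length_append] at hl hm
  have := mt (And.imp List.length_eq_zero_iff.1 List.length_eq_zero_iff.1) h
  omega

lemma len_lt_right {x y x1 y1 x2 y2 : List (Letter deg)} (hx : x1 ++ x2 = x) (hy : y1 ++ y2 = y)
    (h : ¬ (x1 = [] ∧ y1 = [])) : x2.length + y2.length < x.length + y.length := by
  have hl := congrArg List.length hx
  have hm := congrArg List.length hy
  rw [List.length_append] at hl hm
  have := mt (And.imp List.length_eq_zero_iff.1 List.length_eq_zero_iff.1) h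
  omega

lemma wdeg_of_append {x p q : List (Letter deg)} (h : p ++ q = x) : wdeg x = wdeg p + wdeg q := by
  rw [← h, wdeg_append]

lemma S1_tmul {M N : Type*} [AddCommGroup M] [Module K M] [AddCommGroup N] [Module K N]
    {α β : Type*} (x : List α) (y : List β) (φ : List α → List α → M) (ψ : List β → List β → N) :
    S1 x φ ⊗ₜ[K] S1 y ψ = S1 x fun x1 x2 => S1 y fun y1 y2 => φ x1 x2 ⊗ₜ[K] ψ y1 y2 := by
  have h1 := S1_map ((TensorProduct.mk K M N).flip (S1 y ψ)) x φ
  simp only [LinearMap.flip_apply, TensorProduct.mk_apply] at h1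
  rw [h1]
  refine S1_congr fun x1 x2 _ => ?_
  exact S1_map (TensorProduct.mk K M N (φ x1 x2)) y ψ

end WordCoalgebra

section Extension

variable {K : Type*} [Field K] {V : Type*} [AddCommGroup V] [Module K V]
  (deg : ℤ → Submodule K V) [Decomposition deg]

/-- The comultiplication of the tensor product of two copies of the tensor coalgebra,
`x ⊗ y ↦ (-1) ^ (|x₂| |y₁|) (x₁ ⊗ y₁) ⊗ (x₂ ⊗ y₂)`. -/
def deconc2 : T K V ⊗[K] T K V →ₗ[K] (T K V ⊗[K] T K V) ⊗[K] (T K V ⊗[K] T K V) :=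
  midSwap deg ∘ₗ TensorProduct.map (deconc K V) (deconc K V)

variable {deg}

lemma deconc2_word (x y : List (Letter deg)) :
    deconc2 deg (word x ⊗ₜ word y) =
      S2 x y fun x1 y1 x2 y2 => (word x1 ⊗ₜ[K] word y1) ⊗ₜ[K] (word x2 ⊗ₜ[K] word y2) := by
  rw [deconc2, LinearMap.comp_apply, TensorProduct.map_tmul, deconc_word, deconc_word, S2,
    S1_tmul, S1_map]
  apply S1_congr
  intro x1 x2 _
  rw [S1_map]
  apply S1_congr
  intro y1 y2 _
  rw [midSwap_tmul deg (word_mem x2) (word_mem y1)]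

variable {B : Type*} [Ring B] [Algebra K B]

lemma exists_sum_family (P : ℕ → T K V ⊗[K] T K V →ₗ[K] B)
    (hP : ∀ k (x y : List (Letter deg)), x.length + y.length < k → P k (word x ⊗ₜ word y) = 0) :
    ∃ E : T K V ⊗[K] T K V →ₗ[K] B, ∀ (x y : List (Letter deg)) N, x.length + y.length ≤ N →
      E (word x ⊗ₜ word y) = ∑ k ∈ Finset.range (N + 1), P k (word x ⊗ₜ word y) := by
  have hfin : ∀ t, ∃ N, ∀ k, N ≤ k → P k t = 0 := by
    have hw : ∀ (y : List (Letter deg)) (a : T K V), ∃ N, ∀ k, N ≤ k → P k (a ⊗ₜ word y) = 0 := by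
      intro y a
      induction word_span (deg := deg) a using Submodule.span_induction with
      | zero => exact ⟨0, by simp⟩
      | add a b _ _ ha hb =>
        obtain ⟨N, hN⟩ := ha
        obtain ⟨M, hM⟩ := hb
        exact ⟨max N M, fun k hk => by
          rw [add_tmul, map_add, hN k (le_trans (le_max_left _ _) hk),
            hM k (le_trans (le_max_right _ _) hk), add_zero]⟩
      | smul c a _ ha =>
        obtain ⟨N, hN⟩ := ha
        exact ⟨N, fun k hk => by rw [← smul_tmul', map_smul, hN k hk, smul_zero]⟩
      | mem a ha =>
        obtain ⟨x, rfl⟩ := ha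
        exact ⟨x.length + y.length + 1, fun k hk => hP k x y (by omega)⟩
    intro t
    induction t using TensorProduct.induction_on with
    | zero => exact ⟨0, by simp⟩
    | add a b ha hb =>
      obtain ⟨N, hN⟩ := ha
      obtain ⟨M, hM⟩ := hb
      exact ⟨max N M, fun k hk => by
        rw [map_add, hN k (le_trans (le_max_left _ _) hk),
          hM k (le_trans (le_max_right _ _) hk), add_zero]⟩
    | tmul a b =>
      induction word_span (deg := deg) b using Submodule.span_induction with
      | zero => exact ⟨0, by simp⟩
      | add b c _ _ hb hc =>
        obtain ⟨N, hN⟩ := hb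
        obtain ⟨M, hM⟩ := hc
        exact ⟨max N M, fun k hk => by
          rw [tmul_add, map_add, hN k (le_trans (le_max_left _ _) hk),
            hM k (le_trans (le_max_right _ _) hk), add_zero]⟩
      | smul c b _ hb =>
        obtain ⟨N, hN⟩ := hb
        exact ⟨N, fun k hk => by rw [tmul_smul, map_smul, hN k hk, smul_zero]⟩
      | mem b hb =>
        obtain ⟨y, rfl⟩ := hb
        exact hw y a
  have hfs : ∀ t, (Function.support fun k => P k t).Finite := by
    intro t
    obtain ⟨N, hN⟩ := hfin t
    refine (Set.finite_lt_nat N).subset fun k hk => ?_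
    by_contra h
    exact hk (hN k (not_lt.1 h))
  refine ⟨{ toFun := fun t => ∑ᶠ k, P k t
            map_add' := fun s t => by
              simp only [map_add]
              exact finsum_add_distrib (hfs s) (hfs t)
            map_smul' := fun c t => by
              simp only [map_smul, RingHom.id_apply]
              exact (smul_finsum' c (hfs t)).symm }, ?_⟩
  intro x y N hN
  refine finsum_eq_sum_of_support_subset _ fun k hk => ?_
  simp only [Finset.coe_range, Set.mem_Iio]
  by_contra h
  exact hk (hP k x y (by omega))

variable (K V B) in
/-- The counit of the tensor product coalgebra, with values in an algebra. -/
def unit2 : T K V ⊗[K] T K V →ₗ[K] B :=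
  Algebra.linearMap K B ∘ₗ LinearMap.mul' K K ∘ₗ
    TensorProduct.map (counit K V).toLinearMap (counit K V).toLinearMap

@[simp] lemma unit2_tmul (a b : T K V) :
    unit2 K V B (a ⊗ₜ b) = algebraMap K B (counit K V a * counit K V b) := by
  simp [unit2]

lemma unit2_word {x y : List (Letter deg)} (h : x ≠ [] ∨ y ≠ []) :
    unit2 K V B (word x ⊗ₜ word y) = 0 := by
  rcases h with h | h <;> simp [counit_word h]

variable (deg) in
/-- The convolution product of linear maps. -/
def conv2 (f g : T K V ⊗[K] T K V →ₗ[K] B) : T K V ⊗[K] T K V →ₗ[K] B :=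
  LinearMap.mul' K B ∘ₗ TensorProduct.map f g ∘ₗ deconc2 deg

lemma conv2_word (f g : T K V ⊗[K] T K V →ₗ[K] B) (x y : List (Letter deg)) :
    conv2 deg f g (word x ⊗ₜ word y) =
      S2 x y fun x1 y1 x2 y2 => f (word x1 ⊗ₜ word y1) * g (word x2 ⊗ₜ word y2) := by
  rw [conv2, LinearMap.comp_apply, LinearMap.comp_apply, deconc2_word, S2_map, S2_map]
  simp

lemma S2_sum {ι M : Type*} [AddCommGroup M] [Module K M] (s : Finset ι) (x y : List (Letter deg))
    (φ : ι → List (Letter deg) → List (Letter deg) → List (Letter deg) → List (Letter deg) → M) :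
    S2 x y (fun a b c d => ∑ i ∈ s, φ i a b c d) = ∑ i ∈ s, S2 x y (φ i) := by
  classical
  induction s using Finset.induction_on with
  | empty => simp [S2, S1_zero]
  | insert i s hi ih => simp only [Finset.sum_insert hi, S2_add, ih]

lemma exists_ext_left (h : T K V ⊗[K] T K V →ₗ[K] B) (h0 : h (1 ⊗ₜ 1) = 0) :
    ∃ E : T K V ⊗[K] T K V →ₗ[K] B, ∀ x y : List (Letter deg),
      E (word x ⊗ₜ word y) = unit2 K V B (word x ⊗ₜ word y) +
        S2 x y fun x1 y1 x2 y2 => h (word x1 ⊗ₜ word y1) * E (word x2 ⊗ₜ word y2) := by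
  let P : ℕ → T K V ⊗[K] T K V →ₗ[K] B := fun k => (conv2 deg h)^[k] (unit2 K V B)
  have hP : ∀ k, P (k + 1) = conv2 deg h (P k) := fun k => Function.iterate_succ_apply' _ _ _
  have hvan : ∀ k (x y : List (Letter deg)), x.length + y.length < k →
      P k (word x ⊗ₜ word y) = 0 := by
    intro k
    induction k with
    | zero => intro x y hk; omega
    | succ k ih =>
      intro x y hk
      rw [hP, conv2_word]
      refine (Submodule.mem_bot K).1 (S2_mem _ fun x1 y1 x2 y2 hx hy => ?_)
      rw [Submodule.mem_bot]
      have hl := congrArg List.length hx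
      have hm := congrArg List.length hy
      rw [List.length_append] at hl hm
      by_cases hc : x1 = [] ∧ y1 = []
      · rw [hc.1, hc.2]; simp [h0]
      · have := mt (And.imp List.length_eq_zero_iff.1 List.length_eq_zero_iff.1) hc
        rw [ih x2 y2 (by omega), mul_zero]
  obtain ⟨E, hE⟩ := exists_sum_family P hvan
  refine ⟨E, fun x y => ?_⟩
  have h1 : (S2 x y fun x1 y1 x2 y2 => h (word x1 ⊗ₜ word y1) * E (word x2 ⊗ₜ word y2)) =
      S2 x y fun x1 y1 x2 y2 => ∑ k ∈ Finset.range (x.length + y.length + 1),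
        h (word x1 ⊗ₜ word y1) * P k (word x2 ⊗ₜ word y2) := by
    refine S2_congr fun x1 y1 x2 y2 hx hy => ?_
    have hl := congrArg List.length hx
    have hm := congrArg List.length hy
    rw [List.length_append] at hl hm
    rw [hE x2 y2 (x.length + y.length) (by omega), Finset.mul_sum]
  rw [h1, S2_sum, hE x y (x.length + y.length + 1) (by omega), Finset.sum_range_succ', add_comm]
  congr 1
  refine Finset.sum_congr rfl fun k _ => ?_
  rw [hP, conv2_word]

lemma exists_ext_right (h : T K V ⊗[K] T K V →ₗ[K] B) (h0 : h (1 ⊗ₜ 1) = 0) :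
    ∃ E : T K V ⊗[K] T K V →ₗ[K] B, ∀ x y : List (Letter deg),
      E (word x ⊗ₜ word y) = unit2 K V B (word x ⊗ₜ word y) +
        S2 x y fun x1 y1 x2 y2 => E (word x1 ⊗ₜ word y1) * h (word x2 ⊗ₜ word y2) := by
  let P : ℕ → T K V ⊗[K] T K V →ₗ[K] B := fun k => (fun g => conv2 deg g h)^[k] (unit2 K V B)
  have hP : ∀ k, P (k + 1) = conv2 deg (P k) h := fun k => Function.iterate_succ_apply' _ _ _
  have hvan : ∀ k (x y : List (Letter deg)), x.length + y.length < k →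
      P k (word x ⊗ₜ word y) = 0 := by
    intro k
    induction k with
    | zero => intro x y hk; omega
    | succ k ih =>
      intro x y hk
      rw [hP, conv2_word]
      refine (Submodule.mem_bot K).1 (S2_mem _ fun x1 y1 x2 y2 hx hy => ?_)
      rw [Submodule.mem_bot]
      have hl := congrArg List.length hx
      have hm := congrArg List.length hy
      rw [List.length_append] at hl hm
      by_cases hc : x2 = [] ∧ y2 = []
      · rw [hc.1, hc.2]; simp [h0]
      · have := mt (And.imp List.length_eq_zero_iff.1 List.length_eq_zero_iff.1) hc
        rw [ih x1 y1 (by omega), zero_mul]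
  obtain ⟨E, hE⟩ := exists_sum_family P hvan
  refine ⟨E, fun x y => ?_⟩
  have h1 : (S2 x y fun x1 y1 x2 y2 => E (word x1 ⊗ₜ word y1) * h (word x2 ⊗ₜ word y2)) =
      S2 x y fun x1 y1 x2 y2 => ∑ k ∈ Finset.range (x.length + y.length + 1),
        P k (word x1 ⊗ₜ word y1) * h (word x2 ⊗ₜ word y2) := by
    refine S2_congr fun x1 y1 x2 y2 hx hy => ?_
    have hl := congrArg List.length hx
    have hm := congrArg List.length hy
    rw [List.length_append] at hl hm
    rw [hE x1 y1 (x.length + y.length) (by omega), Finset.sum_mul]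
  rw [h1, S2_sum, hE x y (x.length + y.length + 1) (by omega), Finset.sum_range_succ', add_comm]
  congr 1
  refine Finset.sum_congr rfl fun k _ => ?_
  rw [hP, conv2_word]

/-- A linear map to `V` that vanishes at the unit extends to a coalgebra map to `T K V`. -/
lemma exists_coalg_ext (f : T K V ⊗[K] T K V →ₗ[K] V) (h0 : f (1 ⊗ₜ 1) = 0) :
    ∃ E : T K V ⊗[K] T K V →ₗ[K] T K V,
      (∀ x y : List (Letter deg), E (word x ⊗ₜ word y) = unit2 K V (T K V) (word x ⊗ₜ word y) +
        S2 x y fun x1 y1 x2 y2 => gen K V (f (word x1 ⊗ₜ word y1)) * E (word x2 ⊗ₜ word y2)) ∧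
      (∀ x y : List (Letter deg), counit K V (E (word x ⊗ₜ word y)) =
        counit K V (word x) * counit K V (word y)) ∧
      (∀ x y : List (Letter deg), proj1 K V (E (word x ⊗ₜ word y)) = f (word x ⊗ₜ word y)) ∧
      (∀ x y : List (Letter deg), deconc K V (E (word x ⊗ₜ word y)) =
        S2 x y fun x1 y1 x2 y2 => E (word x1 ⊗ₜ word y1) ⊗ₜ E (word x2 ⊗ₜ word y2)) := by
  obtain ⟨E, hE⟩ := exists_ext_left (deg := deg) (gen K V ∘ₗ f) (by simp [h0])
  simp only [LinearMap.comp_apply] at hE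
  have hc : ∀ x y : List (Letter deg), counit K V (E (word x ⊗ₜ word y)) =
      counit K V (word x) * counit K V (word y) := by
    intro x y
    rw [hE, map_add, S2_map]
    simp [S2, S1_zero]
  refine ⟨E, hE, hc, ?_, ?_⟩
  · intro x y
    rw [hE, map_add, S2_map, S2_right]
    · rw [proj1_mul, hc]
      simp [Algebra.algebraMap_eq_smul_one]
    · intro a b c d h
      rw [proj1_mul, hc]
      rcases h with h | h <;> simp [counit_word h]
  · intro x y
    induction hn : x.length + y.length using Nat.strong_induction_on generalizing x y with
    | _ n ih =>
      have e1 : deconc K V (E (word x ⊗ₜ word y)) = 1 ⊗ₜ E (word x ⊗ₜ word y) +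
          S2 x y fun x1 y1 x2 y2 =>
            (LinearMap.mulLeft K (gen K V (f (word x1 ⊗ₜ word y1)))).rTensor (T K V)
              (deconc K V (E (word x2 ⊗ₜ word y2))) := by
        have h3 := S2_map x y (fun x1 y1 x2 y2 =>
          gen K V (f (word x1 ⊗ₜ word y1)) * E (word x2 ⊗ₜ word y2))
          (TensorProduct.mk K (T K V) (T K V) 1)
        simp only [TensorProduct.mk_apply] at h3
        conv_lhs => rw [hE]
        conv_rhs => rw [hE]
        rw [map_add, S2_map, tmul_add, h3]
        simp only [deconc_gen_mul, S2_add]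
        rw [unit2_tmul, Algebra.algebraMap_eq_smul_one, map_smul, deconc_one, tmul_smul]
        abel
      have e2 : ∀ x1 y1 x2 y2 : List (Letter deg), x1 ++ x2 = x → y1 ++ y2 = y →
          (LinearMap.mulLeft K (gen K V (f (word x1 ⊗ₜ word y1)))).rTensor (T K V)
              (deconc K V (E (word x2 ⊗ₜ word y2))) =
            S2 x2 y2 fun a b c d => (gen K V (f (word x1 ⊗ₜ word y1)) * E (word a ⊗ₜ word b)) ⊗ₜ
              E (word c ⊗ₜ word d) := by
        intro x1 y1 x2 y2 hx hy
        have hl := congrArg List.length hx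
        have hm := congrArg List.length hy
        rw [List.length_append] at hl hm
        by_cases hc : x1 = [] ∧ y1 = []
        · have h1 : f (word x1 ⊗ₜ word y1) = 0 := by rw [hc.1, hc.2]; exact h0
          simp [h1, S2, S1_zero]
        · have := mt (And.imp List.length_eq_zero_iff.1 List.length_eq_zero_iff.1) hc
          rw [ih _ (by omega) x2 y2 rfl, S2_map]
          simp
      rw [e1, S2_congr e2, ← S2_assoc x y (fun x1 y1 a b c d =>
        (gen K V (f (word x1 ⊗ₜ word y1)) * E (word a ⊗ₜ word b)) ⊗ₜ E (word c ⊗ₜ word d))]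
      have e3 : ∀ x1 y1 x2 y2 : List (Letter deg),
          (S2 x1 y1 fun a b c d =>
            (gen K V (f (word a ⊗ₜ word b)) * E (word c ⊗ₜ word d)) ⊗ₜ[K] E (word x2 ⊗ₜ word y2)) =
          E (word x1 ⊗ₜ word y1) ⊗ₜ E (word x2 ⊗ₜ word y2) -
            unit2 K V (T K V) (word x1 ⊗ₜ word y1) ⊗ₜ E (word x2 ⊗ₜ word y2) := by
        intro x1 y1 x2 y2
        have h2 := S2_map x1 y1 (fun a b c d =>
          gen K V (f (word a ⊗ₜ word b)) * E (word c ⊗ₜ word d))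
          ((TensorProduct.mk K (T K V) (T K V)).flip (E (word x2 ⊗ₜ word y2)))
        simp only [LinearMap.flip_apply, TensorProduct.mk_apply] at h2
        rw [← h2, ← sub_tmul]
        congr 1
        rw [hE x1 y1]
        abel
      rw [S2_congr fun x1 y1 x2 y2 _ _ => e3 x1 y1 x2 y2, S2_sub,
        S2_left (φ := fun x1 y1 x2 y2 =>
          unit2 K V (T K V) (word x1 ⊗ₜ word y1) ⊗ₜ E (word x2 ⊗ₜ word y2))]
      · simp
      · intro a b c d h
        rw [unit2_word h, zero_tmul]

end Extension

section Structures

variable {K : Type*} [Field K] {V : Type*} [AddCommGroup V] [Module K V]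

/-- A `B_∞` structure on a graded space: a differential `d` of degree `-1` (a square zero
coderivation with `d 1 = 0`) and an associative unital multiplication `mul` of degree `0` on the
tensor coalgebra, such that `mul` is a coalgebra map and `d` is a derivation of `mul`. -/
structure BStr (deg : ℤ → Submodule K V) [Decomposition deg] where
  d : T K V →ₗ[K] T K V
  mul : T K V →ₗ[K] T K V →ₗ[K] T K V
  d_mem : ∀ (n : ℤ) (x : T K V), x ∈ tdeg deg n → d x ∈ tdeg deg (n - 1)
  d_one : d 1 = 0
  d_d : ∀ x, d (d x) = 0
  deconc_d : ∀ x, deconc K V (d x) =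
    TensorProduct.map d LinearMap.id (deconc K V x) +
      TensorProduct.map (signTwist (tdeg deg) 1) d (deconc K V x)
  mul_mem : ∀ (m n : ℤ) (x y : T K V), x ∈ tdeg deg m → y ∈ tdeg deg n →
    mul x y ∈ tdeg deg (m + n)
  one_mul : ∀ x, mul 1 x = x
  mul_one : ∀ x, mul x 1 = x
  mul_assoc : ∀ x y z, mul (mul x y) z = mul x (mul y z)
  counit_mul : ∀ x y, counit K V (mul x y) = counit K V x * counit K V y
  deconc_mul : ∀ x y, deconc K V (mul x y) =
    TensorProduct.map (TensorProduct.lift mul) (TensorProduct.lift mul) (deconc2 deg (x ⊗ₜ y))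
  d_mul : ∀ (n : ℤ) (x y : T K V), x ∈ tdeg deg n →
    d (mul x y) = mul (d x) y + sg K n • mul x (d y)

section

variable {deg : ℤ → Submodule K V} [Decomposition deg]

lemma tmul_deconc_formula (μ : T K V →ₗ[K] T K V →ₗ[K] T K V) {p q : ℤ} {x y : T K V}
    (hx : x ∈ tdeg deg p) (hy : y ∈ tdeg deg q) (a b : T K V) :
    TensorProduct.map (TensorProduct.lift μ) (TensorProduct.lift μ)
      (midSwap deg ((a ⊗ₜ x) ⊗ₜ (y ⊗ₜ b))) = sg K (p * q) • (μ a y ⊗ₜ[K] μ x b) := by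
  rw [midSwap_tmul deg hx hy]
  simp

lemma deconc_mul_word (μ : T K V →ₗ[K] T K V →ₗ[K] T K V) (x y : List (Letter deg)) :
    TensorProduct.map (TensorProduct.lift μ) (TensorProduct.lift μ)
      (deconc2 deg (word x ⊗ₜ word y)) =
    S2 x y fun x1 y1 x2 y2 => μ (word x1) (word y1) ⊗ₜ[K] μ (word x2) (word y2) := by
  rw [deconc2_word, S2_map]
  simp

lemma signTwist_word (l : List (Letter deg)) :
    signTwist (tdeg deg) 1 (word l) = sg K (wdeg l) • word l := by
  rw [signTwist_of_mem _ _ (word_mem l), one_mul]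

lemma deconc_d_word (d : T K V →ₗ[K] T K V) (x : List (Letter deg)) :
    TensorProduct.map d LinearMap.id (deconc K V (word x)) +
      TensorProduct.map (signTwist (tdeg deg) 1) d (deconc K V (word x)) =
    S1 x fun p q => d (word p) ⊗ₜ[K] word q + sg K (wdeg p) • word p ⊗ₜ[K] d (word q) := by
  rw [deconc_word, S1_map, S1_map, ← S1_add]
  simp only [TensorProduct.map_tmul, LinearMap.id_apply, signTwist_word,
    smul_tmul']

end

/-- A 2-associative differential structure on a graded algebra `V`, whose ring multiplication is
the operation `∘`: a second associative multiplication `•` of degree `0` with the same unit, and a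
differential of degree `-1` which is a derivation of `•`. -/
structure TwoAsStr {V : Type*} [Ring V] [Algebra K V] (deg : ℤ → Submodule K V)
    [GradedAlgebra deg] where
  bul : V →ₗ[K] V →ₗ[K] V
  d : V →ₗ[K] V
  bul_mem : ∀ (m n : ℤ) (x y : V), x ∈ deg m → y ∈ deg n → bul x y ∈ deg (m + n)
  one_bul : ∀ x, bul 1 x = x
  bul_one : ∀ x, bul x 1 = x
  bul_assoc : ∀ x y z, bul (bul x y) z = bul x (bul y z)
  d_mem : ∀ (n : ℤ) (x : V), x ∈ deg n → d x ∈ deg (n - 1)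
  d_d : ∀ x, d (d x) = 0
  d_bul : ∀ (n : ℤ) (x y : V), x ∈ deg n → d (bul x y) = bul (d x) y + sg K n • bul x (d y)

end Structures

section Twist

variable {K : Type*} [Field K] {V : Type*} [Ring V] [Algebra K V]

variable (K V) in
/-- Multiplication of generators, `v₁ ⋯ vₖ ↦ v₁ ∘ ⋯ ∘ vₖ`. -/
def multGen : T K V →ₐ[K] V := TensorAlgebra.lift K LinearMap.id

@[simp] lemma multGen_gen (v : V) : multGen K V (gen K V v) = v := by simp [multGen]

variable (K V) in
/-- The unital map `p̃₁ = η ε + p₁` from the tensor coalgebra. -/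
def projTilde : T K V →ₗ[K] V :=
  Algebra.linearMap K V ∘ₗ (counit K V).toLinearMap + proj1 K V

/-- The property defining the twisting `τ` of an associative multiplication: it is a map of unital
coalgebras whose components are the iterated multiplications `v₁ ⋯ vₖ ↦ v₁ ∘ ⋯ ∘ vₖ`, `k ≥ 1`. -/
structure IsTwist (τ : T K V →ₗ[K] T K V) : Prop where
  map_one : τ 1 = 1
  counit_map : ∀ x, counit K V (τ x) = counit K V x
  deconc_map : ∀ x, deconc K V (τ x) = TensorProduct.map τ τ (deconc K V x)
  proj1_map : ∀ x, counit K V x = 0 → proj1 K V (τ x) = multGen K V x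

lemma exists_isTwist (deg : ℤ → Submodule K V) [Decomposition deg] :
    ∃ τ : T K V →ₗ[K] T K V, IsTwist τ := by
  obtain ⟨E, h1, h2, h3, h4⟩ := exists_coalg_ext (deg := deg)
    (TensorProduct.lift (LinearMap.compl₁₂ (LinearMap.lsmul K V).flip
      ((multGen K V).toLinearMap - Algebra.linearMap K V ∘ₗ (counit K V).toLinearMap)
      (counit K V).toLinearMap)) (by simp)
  have h4' : ∀ x : List (Letter deg), deconc K V (E (word x ⊗ₜ 1)) =
      S1 x fun p q => E (word p ⊗ₜ 1) ⊗ₜ[K] E (word q ⊗ₜ 1) := by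
    intro x
    have := h4 x []
    simpa [S2, S1, sg_zero] using this
  let τ : T K V →ₗ[K] T K V := E ∘ₗ (TensorProduct.mk K _ _).flip 1
  have hτ : ∀ x, τ x = E (x ⊗ₜ 1) := fun x => rfl
  have hc : (counit K V).toLinearMap ∘ₗ τ = (counit K V).toLinearMap :=
    lin_ext (deg := deg) fun l => by simpa [hτ] using h2 l []
  have hp : proj1 K V ∘ₗ τ =
      (multGen K V).toLinearMap - Algebra.linearMap K V ∘ₗ (counit K V).toLinearMap :=
    lin_ext (deg := deg) fun l => by simpa [hτ] using h3 l []
  have hd : deconc K V ∘ₗ τ = TensorProduct.map τ τ ∘ₗ deconc K V :=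
    lin_ext (deg := deg) fun l => by
      have h5 := deconc_word l
      rw [LinearMap.comp_apply (TensorProduct.map τ τ), h5, S1_map]
      exact h4' l
  have hone : τ 1 = 1 := by
    have := h1 [] []
    simpa [hτ, S2, S1] using this
  refine ⟨τ, hone, LinearMap.congr_fun hc, LinearMap.congr_fun hd, fun x hx => ?_⟩
  have := LinearMap.congr_fun hp x
  simpa [hx] using this

/-- The twisting determined by the multiplication of `V`. -/
def twist (deg : ℤ → Submodule K V) [Decomposition deg] : T K V →ₗ[K] T K V :=
  Classical.choose (exists_isTwist deg)

lemma twist_isTwist (deg : ℤ → Submodule K V) [Decomposition deg] : IsTwist (twist deg) :=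
  Classical.choose_spec (exists_isTwist deg)

lemma IsTwist.unique (deg : ℤ → Submodule K V) [Decomposition deg] {τ σ : T K V →ₗ[K] T K V}
    (hτ : IsTwist τ) (hσ : IsTwist σ) : τ = σ := by
  apply lin_ext (deg := deg)
  intro x
  rw [← sub_eq_zero]
  refine uniq1 (deg := deg) (fun x => τ (word x) - σ (word x)) (fun x => τ (word x))
    (fun x => σ (word x)) ?_ ?_ hτ.map_one hσ.map_one ?_ x
  · intro x
    rw [map_sub, hτ.counit_map, hσ.counit_map, sub_self]
  · intro x v hv
    have h := congrArg (proj1 K V) hv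
    rw [proj1_gen] at h
    rw [← h]
    cases x with
    | nil => simp [hτ.map_one, hσ.map_one]
    | cons a l =>
      rw [map_sub, hτ.proj1_map _ (by simp), hσ.proj1_map _ (by simp), sub_self]
  · intro x
    rw [map_sub, hτ.deconc_map, hσ.deconc_map, deconc_word, S1_map, S1_map, ← S1_sub]
    refine S1_congr fun p q _ => ?_
    simp only [TensorProduct.map_tmul, sub_tmul, tmul_sub]
    abel

lemma projTilde_twist (deg : ℤ → Submodule K V) [Decomposition deg] :
    projTilde K V ∘ₗ twist deg = (multGen K V).toLinearMap := by
  apply lin_ext (deg := deg)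
  intro l
  have h := twist_isTwist deg
  cases l with
  | nil => simp [projTilde, h.map_one]
  | cons a l =>
    simp only [projTilde, LinearMap.comp_apply, LinearMap.add_apply, AlgHom.toLinearMap_apply,
      h.counit_map, counit_word_cons, map_zero, zero_add]
    exact h.proj1_map _ (by simp)

end Twist

section BStrLemmas

variable {K : Type*} [Field K] {V : Type*} [AddCommGroup V] [Module K V]
  {deg : ℤ → Submodule K V} [Decomposition deg]

lemma counit_counit_deconc_word (x : List (Letter deg)) (D : T K V →ₗ[K] T K V)
    (h : ∀ x : List (Letter deg), deconc K V (D (word x)) =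
      S1 x fun p q => D (word p) ⊗ₜ[K] word q + sg K (wdeg p) • word p ⊗ₜ[K] D (word q)) :
    counit K V (D (word x)) = 0 := by
  have h1 : ∀ t : T K V, LinearMap.mul' K K
      (TensorProduct.map (counit K V).toLinearMap (counit K V).toLinearMap (deconc K V t)) =
      counit K V t := by
    intro t
    have := congrArg (counit K V) (reconstruct t).2
    rw [← this]
    induction deconc K V t using TensorProduct.induction_on with
    | zero => simp
    | add a b ha hb => simp only [map_add, ha, hb]
    | tmul a b => simp
  have h2 := h1 (D (word x))
  rw [h, S1_map, S1_map] at h2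
  have h3 : ∀ p q : List (Letter deg), LinearMap.mul' K K
      (TensorProduct.map (counit K V).toLinearMap (counit K V).toLinearMap
        (D (word p) ⊗ₜ[K] word q + sg K (wdeg p) • word p ⊗ₜ[K] D (word q))) =
      counit K V (D (word p)) * counit K V (word q) +
        sg K (wdeg p) * (counit K V (word p) * counit K V (D (word q))) := by
    intro p q
    simp
  rw [S1_congr fun p q _ => h3 p q, S1_add, S1_right, S1_left] at h2
  · simp only [word_nil, map_one, mul_one, wdeg_nil, sg_zero, one_mul] at h2
    have := add_left_cancel (h2.trans (add_zero _).symm)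
    exact this
  · intro p q hp; simp [counit_word hp]
  · intro p q hq; simp [counit_word hq]

/-- A `B_∞` structure is determined by its two operations. -/
lemma BStr.ext' {S S' : BStr deg} (h1 : S.d = S'.d) (h2 : S.mul = S'.mul) : S = S' := by
  cases S; cases S'; simp only at h1 h2; subst h1 h2; rfl

lemma BStr.deconc_d_word (S : BStr deg) (x : List (Letter deg)) :
    deconc K V (S.d (word x)) =
      S1 x fun p q => S.d (word p) ⊗ₜ[K] word q + sg K (wdeg p) • word p ⊗ₜ[K] S.d (word q) := by
  rw [S.deconc_d, BInfinity.deconc_d_word]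

lemma BStr.deconc_mul_word (S : BStr deg) (x y : List (Letter deg)) :
    deconc K V (S.mul (word x) (word y)) =
      S2 x y fun x1 y1 x2 y2 => S.mul (word x1) (word y1) ⊗ₜ[K] S.mul (word x2) (word y2) := by
  rw [S.deconc_mul, BInfinity.deconc_mul_word]

lemma BStr.counit_d (S : BStr deg) (x : T K V) : counit K V (S.d x) = 0 := by
  have h : (counit K V).toLinearMap ∘ₗ S.d = 0 :=
    lin_ext (deg := deg) fun l => counit_counit_deconc_word l S.d S.deconc_d_word
  exact LinearMap.congr_fun h x

end BStrLemmas

section MulS1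

lemma mul_S1 {α B : Type*} [Ring B] (b : B) (l : List α) (φ : List α → List α → B) :
    b * S1 l φ = S1 l fun p q => b * φ p q := S1_map (AddMonoidHom.mulLeft b) l φ

lemma S1_mul {α B : Type*} [Ring B] (b : B) (l : List α) (φ : List α → List α → B) :
    S1 l φ * b = S1 l fun p q => φ p q * b := S1_map (AddMonoidHom.mulRight b) l φ

end MulS1

section OfWords

variable {K : Type*} [Field K] {V : Type*} [Ring V] [Algebra K V]
  {deg : ℤ → Submodule K V} [GradedAlgebra deg] (A : TwoAsStr deg)

lemma TwoAsStr.d_one : A.d 1 = 0 := by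
  have h := A.d_bul 0 1 1 SetLike.GradedOne.one_mem
  rw [A.bul_one, A.bul_one, sg_zero, one_smul, A.one_bul] at h
  exact (add_eq_left.1 h.symm)

lemma multGen_word_mem (l : List (Letter deg)) : multGen K V (word l) ∈ deg (wdeg l) := by
  induction l with
  | nil => simpa using SetLike.GradedOne.one_mem (A := deg)
  | cons a l ih =>
    rw [word_cons, map_mul, multGen_gen, wdeg_cons]
    exact SetLike.GradedMul.mul_mem a.2.2 ih

lemma eq_zero_of_multGen {v : V} (h : multGen K V (gen K V v) = 0) : v = 0 := by
  simpa using h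

lemma word_proj1 (l : List (Letter deg)) : proj1 K V (word l) ∈ deg (wdeg l) := by
  cases l with
  | nil => simp
  | cons a l =>
    rw [word_cons, proj1_mul]
    cases l with
    | nil => simp
    | cons b l => simp

/-! The differential. -/

lemma conv1_word {B : Type*} [Ring B] [Algebra K B] (f g : T K V →ₗ[K] B)
    (l : List (Letter deg)) :
    LinearMap.mul' K B (TensorProduct.map f g (deconc K V (word l))) =
      S1 l fun p q => f (word p) * g (word q) := by
  rw [deconc_word, S1_map, S1_map]
  simp

lemma exists_coder : ∃ d : T K V →ₗ[K] T K V, d 1 = 0 ∧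
    (∀ x : List (Letter deg), d (word x) ∈ tdeg deg (wdeg x - 1)) ∧
    (∀ x : List (Letter deg), deconc K V (d (word x)) =
      S1 x fun p q => d (word p) ⊗ₜ[K] word q + sg K (wdeg p) • word p ⊗ₜ[K] d (word q)) ∧
    (∀ x : List (Letter deg), multGen K V (d (word x)) = A.d (multGen K V (word x))) := by
  let N : T K V →ₗ[K] V := A.d ∘ₗ (multGen K V).toLinearMap -
    LinearMap.mul' K V ∘ₗ TensorProduct.map (proj1 K V ∘ₗ signTwist (tdeg deg) 1)
      (A.d ∘ₗ (multGen K V).toLinearMap) ∘ₗ deconc K V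
  let u : T K V →ₗ[K] V := Algebra.linearMap K V ∘ₗ (counit K V).toLinearMap
  let m : T K V →ₗ[K] V := LinearMap.mul' K V ∘ₗ TensorProduct.map N (u - proj1 K V) ∘ₗ deconc K V
  let E : T K V →ₗ[K] T K V :=
    LinearMap.mul' K _ ∘ₗ TensorProduct.map (gen K V ∘ₗ m) LinearMap.id ∘ₗ deconc K V
  let d : T K V →ₗ[K] T K V :=
    LinearMap.mul' K _ ∘ₗ TensorProduct.map (signTwist (tdeg deg) 1) E ∘ₗ deconc K V
  have hN0 : N (word ([] : List (Letter deg))) = 0 := by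
    simp [N, A.d_one]
  have hN : ∀ (a : Letter deg) l, N (word (a :: l)) = A.d (multGen K V (word (a :: l))) -
      sg K a.1 • ((a.2 : V) * A.d (multGen K V (word l))) := by
    intro a l
    simp only [N, LinearMap.sub_apply, LinearMap.comp_apply]
    congr 1
    refine (conv1_word (deg := deg) _ _ _).trans ?_
    rw [S1, S1_left]
    · simp only [LinearMap.comp_apply, signTwist_word]
      simp
    · intro p q hp
      rw [LinearMap.comp_apply, signTwist_word, map_smul, word_cons, proj1_mul, counit_word hp,
        counit_gen]
      simp
  have hm : ∀ x : List (Letter deg), m (word x) =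
      S1 x fun p q => N (word p) * (u (word q) - proj1 K V (word q)) :=
    fun x => conv1_word (deg := deg) _ _ _
  have hE : ∀ x : List (Letter deg), E (word x) =
      S1 x fun p q => gen K V (m (word p)) * word q :=
    fun x => conv1_word (deg := deg) _ _ _
  have hd : ∀ x : List (Letter deg), d (word x) =
      S1 x fun p q => (sg K (wdeg p) • word p) * E (word q) := by
    intro x
    refine (conv1_word (deg := deg) _ _ _).trans ?_
    simp only [signTwist_word]
  have hm0 : m (word ([] : List (Letter deg))) = 0 := by
    rw [hm, S1, hN0, zero_mul]
  have hE0 : E (word ([] : List (Letter deg))) = 0 := by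
    rw [hE, S1, hm0, map_zero, zero_mul]
  have hd0 : d (word ([] : List (Letter deg))) = 0 := by
    rw [hd, S1, hE0, mul_zero]
  have hd1 : ∀ (a : Letter deg) l, d (word (a :: l)) =
      E (word (a :: l)) + sg K a.1 • (gen K V (a.2 : V) * d (word l)) := by
    intro a l
    rw [hd, S1, hd l, mul_S1, ← S1_smul]
    congr 1
    · simp [sg_zero]
    · refine S1_congr fun p q _ => ?_
      simp [sg_add, mul_smul, mul_assoc]
  have hmd : ∀ x : List (Letter deg), m (word x) ∈ deg (wdeg x - 1) := by
    intro x
    rw [hm]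
    refine S1_mem _ fun p q hpq => ?_
    rw [wdeg_of_append hpq, show wdeg p + wdeg q - 1 = (wdeg p - 1) + wdeg q by ring]
    refine SetLike.GradedMul.mul_mem ?_ ?_
    · cases p with
      | nil => rw [hN0]; exact zero_mem _
      | cons a l =>
        rw [hN]
        refine sub_mem (A.d_mem _ _ (multGen_word_mem _)) (Submodule.smul_mem _ _ ?_)
        rw [wdeg_cons, add_sub_assoc]
        exact SetLike.GradedMul.mul_mem a.2.2 (A.d_mem _ _ (multGen_word_mem _))
    · refine sub_mem ?_ (word_proj1 _)
      cases q with
      | nil => simpa [u] using SetLike.GradedOne.one_mem (A := deg)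
      | cons a l => simp [u]
  refine ⟨d, hd0, ?_, ?_, ?_⟩
  · intro x
    have hEd : ∀ x : List (Letter deg), E (word x) ∈ tdeg deg (wdeg x - 1) := by
      intro x
      rw [hE]
      refine S1_mem _ fun p q hpq => ?_
      rw [wdeg_of_append hpq, show wdeg p + wdeg q - 1 = (wdeg p - 1) + wdeg q by ring]
      exact SetLike.GradedMul.mul_mem (gen_mem (hmd p)) (word_mem q)
    induction x with
    | nil => rw [hd0]; exact zero_mem _
    | cons a l ih =>
      rw [hd1]
      refine add_mem (hEd _) (Submodule.smul_mem _ _ ?_)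
      rw [wdeg_cons, add_sub_assoc]
      exact SetLike.GradedMul.mul_mem (gen_mem a.2.2) ih
  · have hΔE : ∀ x : List (Letter deg), deconc K V (E (word x)) =
        (S1 x fun p q => E (word p) ⊗ₜ[K] word q) + 1 ⊗ₜ[K] E (word x) := by
      intro x
      have e1 : deconc K V (E (word x)) = (S1 x fun p q => S1 q fun b c =>
          (gen K V (m (word p)) * word b) ⊗ₜ[K] word c) + 1 ⊗ₜ[K] E (word x) := by
        have e3 := S1_map (TensorProduct.mk K (T K V) (T K V) 1) x
          (fun p q => gen K V (m (word p)) * word q)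
        simp only [TensorProduct.mk_apply] at e3
        conv_lhs => rw [hE]
        conv_rhs => rw [hE]
        rw [S1_map, e3, ← S1_add]
        refine S1_congr fun p q _ => ?_
        rw [deconc_gen_mul, deconc_word, S1_map]
        simp
      rw [e1, ← S1_assoc x (fun p b c => (gen K V (m (word p)) * word b) ⊗ₜ[K] word c)]
      congr 1
      refine S1_congr fun p q _ => ?_
      have e3 := S1_map ((TensorProduct.mk K (T K V) (T K V)).flip (word q)) p
          (fun p q => gen K V (m (word p)) * word q)
      simp only [TensorProduct.mk_apply, LinearMap.flip_apply] at e3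
      rw [hE, e3]
    intro x
    induction x with
    | nil => rw [hd0]; simp only [S1]; rw [hd0]; simp
    | cons a l ih =>
      rw [hd1, map_add, map_smul, deconc_gen_mul, ih, hΔE, S1, S1, hE0, hd0, S1_map]
      have e1 : ∀ p q : List (Letter deg),
          d (word (a :: p)) ⊗ₜ[K] word q + sg K (wdeg (a :: p)) • word (a :: p) ⊗ₜ[K] d (word q) =
          E (word (a :: p)) ⊗ₜ[K] word q +
          sg K a.1 • ((LinearMap.mulLeft K (gen K V (a.2 : V))).rTensor (T K V)
            (d (word p) ⊗ₜ[K] word q + sg K (wdeg p) • word p ⊗ₜ[K] d (word q))) := by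
        intro p q
        rw [hd1 a p, wdeg_cons, sg_add]
        simp [add_tmul, smul_tmul', mul_smul]
        abel
      rw [S1_congr fun p q _ => e1 p q, S1_add, S1_smul, hd1]
      simp [sg_zero, tmul_add]
      abel
  · intro x
    induction x with
    | nil => rw [hd0]; simp [A.d_one]
    | cons a l ih =>
      have e1 : ∀ x : List (Letter deg), multGen K V (E (word x)) = N (word x) := by
        intro x
        rw [hE, S1_map]
        have e2 : ∀ p q : List (Letter deg), multGen K V (gen K V (m (word p)) * word q) =
            S1 p fun b c => (N (word b) * (u (word c) - proj1 K V (word c))) *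
              multGen K V (word q) := by
          intro p q
          rw [map_mul, multGen_gen, hm, S1_mul]
        rw [S1_congr fun p q _ => e2 p q, S1_assoc x fun b c q =>
          (N (word b) * (u (word c) - proj1 K V (word c))) * multGen K V (word q)]
        have e3 : ∀ p q : List (Letter deg), (S1 q fun b c =>
            (N (word p) * (u (word b) - proj1 K V (word b))) * multGen K V (word c)) =
            N (word p) * u (word q) := by
          intro p q
          cases q with
          | nil => simp [S1]
          | cons a l =>
            rw [S1, S1_left]
            · simp [u, mul_assoc]
            · intro b c hb
              simp [u, proj1_mul, counit_word hb]
        rw [S1_congr fun p q _ => e3 p q, S1_right]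
        · simp [u]
        · intro p q hq
          simp [u, counit_word hq]
      rw [hd1, map_add, e1, hN, map_smul, map_mul, ih, multGen_gen, sub_add_cancel]

end OfWords

section Multiplication

variable {K : Type*} [Field K] {V : Type*} [Ring V] [Algebra K V]
  {deg : ℤ → Submodule K V} [GradedAlgebra deg] (A : TwoAsStr deg)

lemma sg_neg (n : ℤ) : sg K (-n) = sg K n := by
  rw [sg, zpow_neg, sg, ← inv_zpow, inv_neg, inv_one]

lemma S1_tmul_left {M N α : Type*} [AddCommGroup M] [Module K M] [AddCommGroup N] [Module K N]
    (x : List α) (φ : List α → List α → M) (t : N) :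
    S1 x φ ⊗ₜ[K] t = S1 x fun p q => φ p q ⊗ₜ[K] t :=
  S1_map ((TensorProduct.mk K M N).flip t) x φ

lemma tmul_S1 {M N α : Type*} [AddCommGroup M] [Module K M] [AddCommGroup N] [Module K N]
    (x : List α) (φ : List α → List α → M) (t : N) :
    t ⊗ₜ[K] S1 x φ = S1 x fun p q => t ⊗ₜ[K] φ p q :=
  S1_map (TensorProduct.mk K N M t) x φ

lemma S2_left_of {M : Type*} [AddCommGroup M] [Module K M] {x y : List (Letter deg)}
    {φ : List (Letter deg) → List (Letter deg) → List (Letter deg) → List (Letter deg) → M}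
    (h : ∀ a b c d, a ++ c = x → b ++ d = y → (a ≠ [] ∨ b ≠ []) → φ a b c d = 0) :
    S2 x y φ = φ [] [] x y := by
  classical
  rw [S2_congr (ψ := fun a b c d => if a = [] ∧ b = [] then φ a b c d else 0), S2_left]
  · simp
  · intro a b c d hab
    rw [if_neg (by tauto)]
  · intro a b c d h1 h2
    split_ifs with h3
    · rfl
    · exact h a b c d h1 h2 (by tauto)

lemma exists_mul : ∃ μ : T K V →ₗ[K] T K V →ₗ[K] T K V, μ 1 1 = 1 ∧
    (∀ x y : List (Letter deg), μ (word x) (word y) ∈ tdeg deg (wdeg x + wdeg y)) ∧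
    (∀ x y : List (Letter deg), counit K V (μ (word x) (word y)) =
      counit K V (word x) * counit K V (word y)) ∧
    (∀ x y : List (Letter deg), deconc K V (μ (word x) (word y)) =
      S2 x y fun x1 y1 x2 y2 => μ (word x1) (word y1) ⊗ₜ[K] μ (word x2) (word y2)) ∧
    (∀ x y : List (Letter deg), multGen K V (μ (word x) (word y)) =
      A.bul (multGen K V (word x)) (multGen K V (word y))) := by
  let g : T K V ⊗[K] T K V →ₗ[K] V :=
    TensorProduct.lift (A.bul.compl₁₂ (multGen K V).toLinearMap (multGen K V).toLinearMap)
  have hg : ∀ a b, g (a ⊗ₜ b) = A.bul (multGen K V a) (multGen K V b) := fun a b => rfl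
  let u : T K V ⊗[K] T K V →ₗ[K] V := unit2 K V V
  have hg1 : g (1 ⊗ₜ 1) = 1 := by rw [hg, map_one, A.one_bul]
  have hu1 : u (1 ⊗ₜ 1) = 1 := by simp [u]
  have hgd : ∀ x y : List (Letter deg), g (word x ⊗ₜ word y) ∈ deg (wdeg x + wdeg y) :=
    fun x y => A.bul_mem _ _ _ _ (multGen_word_mem x) (multGen_word_mem y)
  have hud : ∀ x y : List (Letter deg), u (word x ⊗ₜ word y) ∈ deg (wdeg x + wdeg y) := by
    intro x y
    by_cases hc : x = [] ∧ y = []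
    · rw [hc.1, hc.2, word_nil, hu1]; exact SetLike.GradedOne.one_mem (A := deg)
    · rw [not_and_or] at hc
      simp only [u, unit2_word hc]
      exact zero_mem _
  obtain ⟨H, hH⟩ := exists_ext_right (deg := deg) (u - g) (by simp [hg1, hu1])
  have hH1 : H (1 ⊗ₜ 1) = 1 := by
    have := hH [] []
    simpa [S2, S1, hg1, hu1] using this
  have hHd : ∀ x y : List (Letter deg), H (word x ⊗ₜ word y) ∈ deg (wdeg x + wdeg y) := by
    intro x y
    induction hn : x.length + y.length using Nat.strong_induction_on generalizing x y with
    | _ n ih =>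
      rw [hH]
      refine add_mem (hud x y) (S2_mem _ fun x1 y1 x2 y2 hx hy => ?_)
      by_cases hc : x2 = [] ∧ y2 = []
      · rw [hc.1, hc.2]; simp [hg1, hu1]
      · have := len_lt_left hx hy hc
        rw [wdeg_of_append hx, wdeg_of_append hy, add_add_add_comm]
        exact SetLike.GradedMul.mul_mem (ih _ (by omega) x1 y1 rfl)
          (sub_mem (hud x2 y2) (hgd x2 y2))
  obtain ⟨E, hE, hEc, -, hEΔ⟩ := exists_coalg_ext (deg := deg) (u - H) (by simp [hH1, hu1])
  have hE1 : E (1 ⊗ₜ 1) = 1 := by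
    have := hE [] []
    simpa [S2, S1, hH1, hu1] using this
  have hEd : ∀ x y : List (Letter deg), E (word x ⊗ₜ word y) ∈ tdeg deg (wdeg x + wdeg y) := by
    intro x y
    induction hn : x.length + y.length using Nat.strong_induction_on generalizing x y with
    | _ n ih =>
      rw [hE]
      refine add_mem ?_ (S2_mem _ fun x1 y1 x2 y2 hx hy => ?_)
      · by_cases hc : x = [] ∧ y = []
        · rw [hc.1, hc.2, word_nil]
          simpa using SetLike.GradedOne.one_mem (A := tdeg deg)
        · rw [not_and_or] at hc
          simp only [unit2_word hc]
          exact zero_mem _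
      · by_cases hc : x1 = [] ∧ y1 = []
        · rw [hc.1, hc.2]; simp [hH1, hu1]
        · have := len_lt_right hx hy hc
          rw [wdeg_of_append hx, wdeg_of_append hy, add_add_add_comm]
          exact SetLike.GradedMul.mul_mem (gen_mem (sub_mem (hud x1 y1) (hHd x1 y1)))
            (ih _ (by omega) x2 y2 rfl)
  have hHg : ∀ x y : List (Letter deg), (S2 x y fun x1 y1 x2 y2 =>
      H (word x1 ⊗ₜ word y1) * g (word x2 ⊗ₜ word y2)) = u (word x ⊗ₜ word y) := by
    intro x y
    have h1 := hH x y
    simp only [LinearMap.sub_apply, mul_sub, S2_sub] at h1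
    rw [S2_right (φ := fun x1 y1 x2 y2 => H (word x1 ⊗ₜ word y1) * u (word x2 ⊗ₜ word y2))] at h1
    · simp only [word_nil, hu1, mul_one] at h1
      have h2 : u (word x ⊗ₜ word y) = unit2 K V V (word x ⊗ₜ word y) := rfl
      rw [h2]
      rw [← sub_eq_zero]
      have h3 := sub_eq_zero.2 h1
      rw [← h3]
      abel
    · intro a b c d h
      simp [u, unit2_word h, -unit2_tmul]
  have hmE : ∀ x y : List (Letter deg), (S2 x y fun x1 y1 x2 y2 =>
      H (word x1 ⊗ₜ word y1) * multGen K V (E (word x2 ⊗ₜ word y2))) = u (word x ⊗ₜ word y) := by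
    intro x y
    have h1 := congrArg (multGen K V) (hE x y)
    rw [map_add, S2_map] at h1
    simp only [map_mul, multGen_gen, LinearMap.sub_apply, sub_mul, S2_sub] at h1
    rw [S2_left (φ := fun x1 y1 x2 y2 => u (word x1 ⊗ₜ word y1) *
      multGen K V (E (word x2 ⊗ₜ word y2)))] at h1
    · simp only [word_nil, hu1, one_mul] at h1
      have h2 : u (word x ⊗ₜ word y) = multGen K V (unit2 K V (T K V) (word x ⊗ₜ word y)) := by
        simp [u]
      rw [h2]
      rw [← sub_eq_zero]
      have h3 := sub_eq_zero.2 h1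
      rw [← h3]
      abel
    · intro a b c d h
      simp [u, unit2_word h, -unit2_tmul]
  have hfin : ∀ x y : List (Letter deg),
      multGen K V (E (word x ⊗ₜ word y)) - g (word x ⊗ₜ word y) = 0 := by
    intro x y
    induction hn : x.length + y.length using Nat.strong_induction_on generalizing x y with
    | _ n ih =>
      have h1 := hmE x y
      rw [← hHg x y, ← sub_eq_zero, ← S2_sub, S2_left_of] at h1
      · simpa [hH1, mul_sub] using h1
      · intro a b c d hx hy hab
        have := len_lt_right hx hy (by tauto)
        rw [← mul_sub, ih _ (by omega) c d rfl, mul_zero]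
  refine ⟨TensorProduct.curry E, hE1, hEd, hEc, hEΔ, fun x y => ?_⟩
  exact sub_eq_zero.1 (hfin x y)

/-- The components of a 2-associative differential structure determine a `B_∞` structure. -/
lemma exists_bStr : ∃ S : BStr deg,
    (∀ x y, multGen K V (S.mul x y) = A.bul (multGen K V x) (multGen K V y)) ∧
    (∀ x, multGen K V (S.d x) = A.d (multGen K V x)) := by
  obtain ⟨d, hd1, hdd, hdΔ, hdm⟩ := exists_coder A
  obtain ⟨μ, hμ1, hμd, hμc, hμΔ, hμm⟩ := exists_mul A
  -- extension of the formulas from words to all elements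
  have hdm' : ∀ x, multGen K V (d x) = A.d (multGen K V x) := by
    have h : (multGen K V).toLinearMap ∘ₗ d = A.d ∘ₗ (multGen K V).toLinearMap :=
      lin_ext (deg := deg) hdm
    exact LinearMap.congr_fun h
  have hμm' : ∀ x y, multGen K V (μ x y) = A.bul (multGen K V x) (multGen K V y) := by
    have h : μ.compr₂ (multGen K V).toLinearMap =
        A.bul.compl₁₂ (multGen K V).toLinearMap (multGen K V).toLinearMap :=
      lin_ext2 (deg := deg) hμm
    exact fun x y => LinearMap.congr_fun₂ h x y
  have hdmem : ∀ (n : ℤ) (x : T K V), x ∈ tdeg deg n → d x ∈ tdeg deg (n - 1) := by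
    intro n x hx
    induction hx using Submodule.span_induction with
    | mem x hx => obtain ⟨l, rfl, rfl⟩ := hx; exact hdd l
    | zero => rw [map_zero]; exact zero_mem _
    | add x y _ _ h1 h2 => rw [map_add]; exact add_mem h1 h2
    | smul c x _ h => rw [map_smul]; exact Submodule.smul_mem _ _ h
  have hμmem : ∀ (m n : ℤ) (x y : T K V), x ∈ tdeg deg m → y ∈ tdeg deg n →
      μ x y ∈ tdeg deg (m + n) := by
    intro m n x y hx hy
    induction hx, hy using Submodule.span_induction₂ with
    | mem_mem x y hx hy =>
      obtain ⟨l, rfl, rfl⟩ := hx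
      obtain ⟨m, rfl, rfl⟩ := hy
      exact hμd l m
    | zero_left => simp
    | zero_right => simp
    | add_left x y z _ _ _ h1 h2 => rw [map_add, LinearMap.add_apply]; exact add_mem h1 h2
    | add_right x y z _ _ _ h1 h2 => rw [map_add]; exact add_mem h1 h2
    | smul_left r x y _ _ h =>
      rw [map_smul, LinearMap.smul_apply]; exact Submodule.smul_mem _ _ h
    | smul_right r x y _ _ h => rw [map_smul]; exact Submodule.smul_mem _ _ h
  have hμc' : ∀ x y, counit K V (μ x y) = counit K V x * counit K V y := by
    have h : μ.compr₂ (counit K V).toLinearMap =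
        (LinearMap.mul K K).compl₁₂ (counit K V).toLinearMap (counit K V).toLinearMap :=
      lin_ext2 (deg := deg) hμc
    exact fun x y => LinearMap.congr_fun₂ h x y
  have hdc : ∀ x : T K V, counit K V (d x) = 0 := by
    have h : (counit K V).toLinearMap ∘ₗ d = 0 :=
      lin_ext (deg := deg) fun l => counit_counit_deconc_word l d hdΔ
    exact LinearMap.congr_fun h
  have hdΔ' : ∀ x, deconc K V (d x) = TensorProduct.map d LinearMap.id (deconc K V x) +
      TensorProduct.map (signTwist (tdeg deg) 1) d (deconc K V x) := by
    have h : deconc K V ∘ₗ d = TensorProduct.map d LinearMap.id ∘ₗ deconc K V +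
        TensorProduct.map (signTwist (tdeg deg) 1) d ∘ₗ deconc K V :=
      lin_ext (deg := deg) fun l => by
        rw [LinearMap.comp_apply, hdΔ, ← deconc_d_word]; rfl
    exact LinearMap.congr_fun h
  let Ψ : (T K V ⊗[K] T K V) ⊗[K] (T K V ⊗[K] T K V) →ₗ[K] T K V ⊗[K] T K V :=
    TensorProduct.map (TensorProduct.lift μ) (TensorProduct.lift μ) ∘ₗ midSwap deg
  have hΨ : ∀ {p q : ℤ} {x y : T K V}, x ∈ tdeg deg p → y ∈ tdeg deg q → ∀ a b : T K V,
      Ψ ((a ⊗ₜ x) ⊗ₜ (y ⊗ₜ b)) = sg K (p * q) • (μ a y ⊗ₜ[K] μ x b) :=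
    fun hx hy a b => tmul_deconc_formula μ hx hy a b
  have hμΔ' : ∀ x y, deconc K V (μ x y) = Ψ (deconc K V x ⊗ₜ deconc K V y) := by
    have h : μ.compr₂ (deconc K V) =
        ((TensorProduct.mk K _ _).compl₁₂ (deconc K V) (deconc K V)).compr₂ Ψ := by
      refine lin_ext2 (deg := deg) fun x y => ?_
      rw [LinearMap.compr₂_apply, hμΔ, ← deconc_mul_word]
      rfl
    exact fun x y => LinearMap.congr_fun₂ h x y
  have hgen : ∀ {t : T K V} {v : V}, t = gen K V v → multGen K V t = 0 → v = 0 := by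
    intro t v h h0
    rw [h] at h0
    exact eq_zero_of_multGen h0
  have hone : ∀ x, μ 1 x = x := by
    have h : μ 1 = LinearMap.id := lin_ext (deg := deg) fun x => by
      rw [← sub_eq_zero]
      refine uniq1 (deg := deg) (fun x => μ 1 (word x) - word x) (fun x => μ 1 (word x))
        (fun x => word x) ?_ (fun x v h => hgen h ?_) hμ1 rfl ?_ x
      · intro x; rw [map_sub, hμc', map_one, one_mul, sub_self]
      · rw [map_sub, hμm', map_one, A.one_bul, sub_self]
      · intro x
        have e := hμΔ [] x
        rw [word_nil] at e
        rw [map_sub, e, deconc_word, S2, S1, ← S1_sub]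
        refine S1_congr fun p q _ => ?_
        simp only [wdeg_nil, zero_mul, sg_zero, one_smul, word_nil, sub_tmul, tmul_sub]
        abel
    exact LinearMap.congr_fun h
  have hone' : ∀ x, μ x 1 = x := by
    have h : μ.flip 1 = LinearMap.id := lin_ext (deg := deg) fun x => by
      rw [← sub_eq_zero]
      refine uniq1 (deg := deg) (fun x => μ (word x) 1 - word x) (fun x => μ (word x) 1)
        (fun x => word x) ?_ (fun x v h => hgen h ?_) hμ1 rfl ?_ x
      · intro x; rw [map_sub, hμc', map_one, mul_one, sub_self]
      · rw [map_sub, hμm', map_one, A.bul_one, sub_self]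
      · intro x
        have e := hμΔ x []
        rw [word_nil] at e
        rw [map_sub, e, deconc_word, S2, ← S1_sub]
        refine S1_congr fun p q _ => ?_
        simp only [S1, wdeg_nil, mul_zero, sg_zero, one_smul, word_nil, sub_tmul, tmul_sub]
        abel
    exact LinearMap.congr_fun h
  have hdd0 : ∀ x, d (d x) = 0 := by
    have h : d ∘ₗ d = 0 := lin_ext (deg := deg) fun x => by
      refine uniq1 (deg := deg) (fun x => d (d (word x))) (fun x => word x)
        (fun x => word x) ?_ (fun x v h => hgen h ?_) rfl rfl ?_ x
      · intro x; rw [hdc]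
      · rw [hdm', hdm', A.d_d]
      · intro x
        rw [hdΔ', hdΔ, S1_map, S1_map, ← S1_add]
        refine S1_congr fun p q _ => ?_
        simp only [map_add, TensorProduct.map_tmul, LinearMap.id_apply, map_smul,
          signTwist_word, signTwist_of_mem _ _ (hdd p), ← smul_tmul', one_mul, sg_sub_one,
          smul_smul, sg_mul_self, one_smul]
        module
    exact LinearMap.congr_fun h
  have hassoc : ∀ x y z, μ (μ x y) z = μ x (μ y z) := by
    have h : ∀ x y z : List (Letter deg),
        μ (μ (word x) (word y)) (word z) = μ (word x) (μ (word y) (word z)) := by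
      intro x y z
      rw [← sub_eq_zero]
      refine uniq3 (deg := deg)
        (fun x y z => μ (μ (word x) (word y)) (word z) - μ (word x) (μ (word y) (word z)))
        (fun x y z => μ (μ (word x) (word y)) (word z))
        (fun x y z => μ (word x) (μ (word y) (word z)))
        ?_ (fun x y z v h => hgen h ?_) (by simp [hμ1]) (by simp [hμ1]) ?_ x y z
      · intro x y z
        simp only [map_sub, hμc', mul_assoc, sub_self]
      · simp only [map_sub, hμm', A.bul_assoc, sub_self]
      · intro x y z
        have e1 : deconc K V (μ (μ (word x) (word y)) (word z)) =
            S2 x y fun x1 y1 x2 y2 => S1 z fun z1 z2 => sg K ((wdeg x2 + wdeg y2) * wdeg z1) •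
              (μ (μ (word x1) (word y1)) (word z1) ⊗ₜ[K] μ (μ (word x2) (word y2)) (word z2)) := by
          rw [hμΔ', hμΔ, deconc_word, S2, S1_tmul_left, S1_map]
          refine S1_congr fun x1 x2 _ => ?_
          rw [S1_tmul_left, S1_map]
          refine S1_congr fun y1 y2 _ => ?_
          rw [← smul_tmul', map_smul, tmul_S1, S1_map]
          congr 1
          refine S1_congr fun z1 z2 _ => ?_
          exact hΨ (hμd x2 y2) (word_mem z1) _ _
        have e2 : deconc K V (μ (word x) (μ (word y) (word z))) =
            S2 x y fun x1 y1 x2 y2 => S1 z fun z1 z2 => sg K ((wdeg x2 + wdeg y2) * wdeg z1) •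
              (μ (word x1) (μ (word y1) (word z1)) ⊗ₜ[K] μ (word x2) (μ (word y2) (word z2))) := by
          rw [hμΔ', hμΔ, deconc_word, S2, S1_tmul_left, S1_map]
          refine S1_congr fun x1 x2 _ => ?_
          rw [tmul_S1, S1_map]
          refine S1_congr fun y1 y2 _ => ?_
          rw [tmul_S1, S1_map, ← S1_smul]
          refine S1_congr fun z1 z2 _ => ?_
          rw [tmul_smul, map_smul, hΨ (word_mem x2) (hμd y1 z1), smul_smul, smul_smul, ← sg_add,
            ← sg_add]
          congr 2
          ring
        rw [map_sub, e1, e2, ← S2_sub]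
        refine S2_congr fun x1 y1 x2 y2 _ _ => ?_
        rw [← S1_sub]
        refine S1_congr fun z1 z2 _ => ?_
        simp only [sub_tmul, tmul_sub]
        module
    have h2 : ∀ (z : List (Letter deg)) (x y : T K V), μ (μ x y) (word z) = μ x (μ y (word z)) := by
      intro z
      have h3 : μ.compr₂ (μ.flip (word z)) = μ.compl₂ (μ.flip (word z)) :=
        lin_ext2 (deg := deg) fun x y => h x y z
      exact fun x y => LinearMap.congr_fun₂ h3 x y
    intro x y
    have h3 : μ (μ x y) = μ x ∘ₗ μ y := lin_ext (deg := deg) fun z => h2 z x y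
    exact LinearMap.congr_fun h3
  have hder : ∀ (n : ℤ) (x y : T K V), x ∈ tdeg deg n →
      d (μ x y) = μ (d x) y + sg K n • μ x (d y) := by
    have h : ∀ x y : List (Letter deg), d (μ (word x) (word y)) =
        μ (d (word x)) (word y) + sg K (wdeg x) • μ (word x) (d (word y)) := by
      intro x y
      rw [← sub_eq_zero]
      refine uniq2 (deg := deg)
        (fun x y => d (μ (word x) (word y)) -
          (μ (d (word x)) (word y) + sg K (wdeg x) • μ (word x) (d (word y))))
        (fun x y => μ (word x) (word y))
        (fun x y => sg K (wdeg x + wdeg y) • μ (word x) (word y))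
        ?_ (fun x y v h => hgen h ?_) hμ1 (by simp [hμ1, sg_zero]) ?_ x y
      · intro x y
        simp [hμc', hdc]
      · simp only [map_sub, map_add, map_smul, hμm', hdm']
        rw [A.d_bul _ _ _ (multGen_word_mem x), sub_self]
      · intro x y
        have e1 : deconc K V (d (μ (word x) (word y))) = S2 x y fun x1 y1 x2 y2 =>
            d (μ (word x1) (word y1)) ⊗ₜ[K] μ (word x2) (word y2) +
            sg K (wdeg x1 + wdeg y1) • (μ (word x1) (word y1) ⊗ₜ[K] d (μ (word x2) (word y2))) := by
          rw [hdΔ', hμΔ, S2_map, S2_map, ← S2_add]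
          refine S2_congr fun x1 y1 x2 y2 _ _ => ?_
          rw [TensorProduct.map_tmul, TensorProduct.map_tmul, LinearMap.id_apply,
            signTwist_of_mem _ _ (hμd x1 y1), one_mul, smul_tmul']
        have e2 : deconc K V (μ (d (word x)) (word y)) = S2 x y fun x1 y1 x2 y2 =>
            μ (d (word x1)) (word y1) ⊗ₜ[K] μ (word x2) (word y2) +
            (sg K (wdeg x1) * sg K (wdeg y1)) •
              (μ (word x1) (word y1) ⊗ₜ[K] μ (d (word x2)) (word y2)) := by
          rw [hμΔ', hdΔ, deconc_word, S1_tmul, S1_map, S2]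
          refine S1_congr fun x1 x2 _ => ?_
          rw [S1_map]
          refine S1_congr fun y1 y2 _ => ?_
          rw [add_tmul, map_add, hΨ (word_mem x2) (word_mem y1), ← smul_tmul',
            map_smul, hΨ (hdd x2) (word_mem y1), smul_add, smul_smul, smul_smul, sub_mul, one_mul,
            sub_eq_add_neg, sg_add, sg_neg]
          congr 2
          ring
        have e3 : deconc K V (sg K (wdeg x) • μ (word x) (d (word y))) =
            S2 x y fun x1 y1 x2 y2 =>
            (sg K (wdeg x1) • μ (word x1) (d (word y1))) ⊗ₜ[K] μ (word x2) (word y2) +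
            sg K (wdeg x1 + wdeg y1) •
              (μ (word x1) (word y1) ⊗ₜ[K] (sg K (wdeg x2) • μ (word x2) (d (word y2)))) := by
          rw [map_smul, hμΔ', hdΔ, deconc_word, S1_tmul, S1_map, S2, ← S1_smul]
          refine S1_congr fun x1 x2 hx => ?_
          rw [S1_map, ← S1_smul]
          refine S1_congr fun y1 y2 _ => ?_
          have hs := sg_mul_self K (wdeg x2)
          rw [tmul_add, map_add, hΨ (word_mem x2) (hdd y1), ← smul_tmul', tmul_smul,
            map_smul, hΨ (word_mem x2) (word_mem y1), wdeg_of_append hx, mul_sub,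
            mul_one, sub_eq_add_neg, sg_add, sg_add, sg_add, sg_neg]
          simp only [smul_add, smul_smul, tmul_smul]
          congr 2
          · linear_combination (sg K (wdeg x1) * sg K (wdeg x2 * wdeg y1)) * hs
          · ring
        rw [map_sub, map_add, e1, e2, e3, ← S2_add, ← S2_sub]
        refine S2_congr fun x1 y1 x2 y2 _ _ => ?_
        simp only [sub_tmul, tmul_sub, add_tmul, tmul_add, sg_add, ← smul_tmul', tmul_smul]
        module
    intro n x y hx
    have h2 : ∀ x : List (Letter deg), d ∘ₗ μ (word x) =
        μ (d (word x)) + sg K (wdeg x) • (μ (word x) ∘ₗ d) :=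
      fun x => lin_ext (deg := deg) fun y => h x y
    induction hx using Submodule.span_induction with
    | mem x hx => obtain ⟨l, rfl, rfl⟩ := hx; exact LinearMap.congr_fun (h2 l) y
    | zero => simp
    | add a b _ _ ha hb =>
      simp only [map_add, LinearMap.add_apply, ha, hb, smul_add]
      abel
    | smul c a _ ha =>
      simp only [map_smul, LinearMap.smul_apply, ha, smul_add]
      rw [smul_comm c]
  exact ⟨⟨d, μ, hdmem, hd1, hdd0, hdΔ', hμmem, hone, hone', hassoc, hμc',
    fun x y => (hμΔ' x y), hder⟩, hμm', hdm'⟩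

end Multiplication

section Naturality

variable {K : Type*} [Field K] {V W X : Type*} [AddCommGroup V] [Module K V]
  [AddCommGroup W] [Module K W] [AddCommGroup X] [Module K X]
  {deg : ℤ → Submodule K V} [Decomposition deg] {deg' : ℤ → Submodule K W} [Decomposition deg']

@[simp] lemma counit_tmap (f : V →ₗ[K] W) (x : T K V) :
    counit K W (tmap f x) = counit K V x := by
  have h : (counit K W).comp (tmap f) = counit K V := by
    apply TensorAlgebra.hom_ext
    ext v
    simp only [LinearMap.comp_apply, AlgHom.toLinearMap_apply, AlgHom.comp_apply]
    rw [tmap_gen, counit_gen, counit_gen]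
  exact DFunLike.congr_fun h x

lemma deconc_tmap (f : V →ₗ[K] W) (x : T K V) :
    deconc K W (tmap f x) =
      TensorProduct.map (tmap f).toLinearMap (tmap f).toLinearMap (deconc K V x) := by
  induction x using T_induction with
  | one => simp
  | add x y hx hy => simp only [map_add, hx, hy]
  | smul c x hx => simp only [map_smul, hx]
  | gen_mul v x hx =>
    rw [map_mul, tmap_gen, deconc_gen_mul, deconc_gen_mul, hx, map_add, TensorProduct.map_tmul]
    simp only [AlgHom.toLinearMap_apply, map_mul, map_one, tmap_gen]
    congr 1
    generalize deconc K V x = t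
    induction t with
    | zero => simp
    | add a b ha hb => simp only [map_add, ha, hb]
    | tmul a b => simp

@[simp] lemma proj1_tmap (f : V →ₗ[K] W) (x : T K V) :
    proj1 K W (tmap f x) = f (proj1 K V x) := by
  induction x using T_induction with
  | one => simp
  | add x y hx hy => simp only [map_add, hx, hy]
  | smul c x hx => simp only [map_smul, hx]
  | gen_mul v x hx =>
    rw [map_mul, tmap_gen, proj1_mul, proj1_mul]
    simp only [counit_tmap, counit_gen, proj1_gen, zero_smul, zero_add, map_smul]

@[simp] lemma tmap_id (x : T K V) : tmap (LinearMap.id : V →ₗ[K] V) x = x := by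
  have h : tmap (LinearMap.id : V →ₗ[K] V) = AlgHom.id K _ := by
    apply TensorAlgebra.hom_ext
    ext v
    simp only [LinearMap.comp_apply, AlgHom.toLinearMap_apply, AlgHom.id_apply]
    rw [tmap_gen, LinearMap.id_apply]
  rw [h, AlgHom.id_apply]

lemma tmap_comp (g : W →ₗ[K] X) (f : V →ₗ[K] W) (x : T K V) :
    tmap (g ∘ₗ f) x = tmap g (tmap f x) := by
  have h : tmap (g ∘ₗ f) = (tmap g).comp (tmap f) := by
    apply TensorAlgebra.hom_ext
    ext v
    simp only [LinearMap.comp_apply, AlgHom.toLinearMap_apply, AlgHom.comp_apply]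
    rw [tmap_gen, tmap_gen, tmap_gen, LinearMap.comp_apply]
  rw [h, AlgHom.comp_apply]

/-- The image of a homogeneous element under a map of degree `0`. -/
def letterMap (f : V →ₗ[K] W) (hf : ∀ n, ∀ v ∈ deg n, f v ∈ deg' n) (a : Letter deg) :
    Letter deg' := ⟨a.1, f a.2, hf _ _ a.2.2⟩

lemma tmap_word (f : V →ₗ[K] W) (hf : ∀ n, ∀ v ∈ deg n, f v ∈ deg' n) (l : List (Letter deg)) :
    tmap f (word l) = word (l.map (letterMap f hf)) := by
  induction l with
  | nil => simp
  | cons a l ih => rw [word_cons, map_mul, ih, tmap_gen, List.map_cons, word_cons]; rfl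

lemma wdeg_map (f : V →ₗ[K] W) (hf : ∀ n, ∀ v ∈ deg n, f v ∈ deg' n) (l : List (Letter deg)) :
    wdeg (l.map (letterMap f hf)) = wdeg l := by
  induction l with
  | nil => simp
  | cons a l ih => rw [List.map_cons, wdeg_cons, ih, wdeg_cons]; rfl

lemma tmap_mem (f : V →ₗ[K] W) (hf : ∀ n, ∀ v ∈ deg n, f v ∈ deg' n) {n : ℤ} {x : T K V}
    (hx : x ∈ tdeg deg n) : tmap f x ∈ tdeg deg' n := by
  induction hx using Submodule.span_induction with
  | mem x hx =>
    obtain ⟨l, rfl, rfl⟩ := hx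
    rw [tmap_word f hf]
    exact word_mem_of_eq _ (wdeg_map f hf l)
  | zero => simp
  | add x y _ _ hx hy => rw [map_add]; exact add_mem hx hy
  | smul c x _ hx => rw [map_smul]; exact Submodule.smul_mem _ _ hx

lemma S1_list_map {α β M : Type*} [AddCommGroup M] (g : α → β) (x : List α)
    (φ : List β → List β → M) :
    S1 (x.map g) φ = S1 x fun p q => φ (p.map g) (q.map g) := by
  induction x generalizing φ with
  | nil => simp [S1]
  | cons a l ih => simp [S1, ih]

lemma S2_list_map {M : Type*} [AddCommGroup M] [Module K M] (f : V →ₗ[K] W)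
    (hf : ∀ n, ∀ v ∈ deg n, f v ∈ deg' n) (x y : List (Letter deg))
    (φ : List (Letter deg') → List (Letter deg') → List (Letter deg') → List (Letter deg') → M) :
    S2 (x.map (letterMap f hf)) (y.map (letterMap f hf)) φ = S2 x y fun a b c d =>
      φ (a.map (letterMap f hf)) (b.map (letterMap f hf)) (c.map (letterMap f hf))
        (d.map (letterMap f hf)) := by
  simp only [S2, S1_list_map, wdeg_map]

variable {S : BStr deg} {S' : BStr deg'} {f : V →ₗ[K] W}

/-- A map which is injective on generators detects whether `T(f)` commutes with differentials. -/
lemma tmap_d_of (hf : ∀ n, ∀ v ∈ deg n, f v ∈ deg' n) (π : T K W →ₗ[K] X)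
    (hπ : ∀ v, π (gen K W v) = 0 → v = 0) (h : ∀ x, π (S'.d (tmap f x)) = π (tmap f (S.d x)))
    (x : T K V) : S'.d (tmap f x) = tmap f (S.d x) := by
  have h1 : S'.d ∘ₗ (tmap f).toLinearMap = (tmap f).toLinearMap ∘ₗ S.d :=
    lin_ext (deg := deg) fun x => by
      rw [LinearMap.comp_apply, LinearMap.comp_apply, AlgHom.toLinearMap_apply,
        AlgHom.toLinearMap_apply, ← sub_eq_zero]
      refine uniq1 (deg := deg) (fun x => S'.d (tmap f (word x)) - tmap f (S.d (word x)))
        (fun x => tmap f (word x)) (fun x => sg K (wdeg x) • tmap f (word x)) ?_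
        (fun x v hv => hπ v ?_) (by simp) (by simp [sg_zero]) ?_ x
      · intro x
        rw [map_sub, S'.counit_d, counit_tmap, S.counit_d, sub_self]
      · rw [← hv, map_sub, h, sub_self]
      · intro x
        rw [map_sub, deconc_tmap, S.deconc_d_word, tmap_word f hf, S'.deconc_d_word, S1_list_map,
          S1_map, ← S1_sub]
        refine S1_congr fun p q _ => ?_
        simp only [← tmap_word f hf, wdeg_map, map_add, map_smul, TensorProduct.map_tmul,
          AlgHom.toLinearMap_apply, sub_tmul, tmul_sub, smul_tmul']
        abel
  exact LinearMap.congr_fun h1 x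

/-- A map which is injective on generators detects whether `T(f)` commutes with
multiplications. -/
lemma tmap_mul_of (hf : ∀ n, ∀ v ∈ deg n, f v ∈ deg' n) (π : T K W →ₗ[K] X)
    (hπ : ∀ v, π (gen K W v) = 0 → v = 0)
    (h : ∀ x y, π (S'.mul (tmap f x) (tmap f y)) = π (tmap f (S.mul x y)))
    (x y : T K V) : S'.mul (tmap f x) (tmap f y) = tmap f (S.mul x y) := by
  have h1 : S'.mul.compl₁₂ (tmap f).toLinearMap (tmap f).toLinearMap =
      S.mul.compr₂ (tmap f).toLinearMap :=
    lin_ext2 (deg := deg) fun x y => by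
      rw [LinearMap.compl₁₂_apply, LinearMap.compr₂_apply, AlgHom.toLinearMap_apply,
        AlgHom.toLinearMap_apply, AlgHom.toLinearMap_apply, ← sub_eq_zero]
      refine uniq2 (deg := deg)
        (fun x y => S'.mul (tmap f (word x)) (tmap f (word y)) - tmap f (S.mul (word x) (word y)))
        (fun x y => S'.mul (tmap f (word x)) (tmap f (word y)))
        (fun x y => tmap f (S.mul (word x) (word y))) ?_
        (fun x y v hv => hπ v ?_) (by simp [S'.one_mul]) (by simp [S.one_mul]) ?_ x y
      · intro x y
        simp only [map_sub, S'.counit_mul, counit_tmap, S.counit_mul, sub_self]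
      · rw [← hv, map_sub, h, sub_self]
      · intro x y
        rw [map_sub, deconc_tmap, S.deconc_mul_word, tmap_word f hf, tmap_word f hf,
          S'.deconc_mul_word, S2_map, S2_list_map, ← S2_sub]
        refine S2_congr fun a b c d _ _ => ?_
        simp only [← tmap_word f hf, TensorProduct.map_tmul, AlgHom.toLinearMap_apply, sub_tmul,
          tmul_sub]
        abel
  exact LinearMap.congr_fun₂ h1 x y

end Naturality
section Underlying

variable {K : Type*} [Field K] {V : Type*} [Ring V] [Algebra K V]
  {deg : ℤ → Submodule K V} [GradedAlgebra deg]

/-- The defining property of the underlying `B_∞` structure of a 2-associative differential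
algebra: the components `p₁ τ` of the twisting `τ` carry `μ` to `•` and `d` to `∂`, on the kernel
of the counit. -/
structure IsUnderlying (A : TwoAsStr deg) (S : BStr deg) : Prop where
  mul_eq : ∀ x y, counit K V x = 0 → counit K V y = 0 → proj1 K V (twist deg (S.mul x y)) =
    A.bul (proj1 K V (twist deg x)) (proj1 K V (twist deg y))
  d_eq : ∀ x, counit K V x = 0 →
    proj1 K V (twist deg (S.d x)) = A.d (proj1 K V (twist deg x))

lemma proj1_twist {x : T K V} (hx : counit K V x = 0) :
    proj1 K V (twist deg x) = multGen K V x :=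
  (twist_isTwist deg).proj1_map x hx

lemma exists_isUnderlying (A : TwoAsStr deg) : ∃ S : BStr deg, IsUnderlying A S := by
  obtain ⟨S, h1, h2⟩ := exists_bStr A
  refine ⟨S, fun x y hx hy => ?_, fun x hx => ?_⟩
  · rw [proj1_twist hx, proj1_twist hy, ← h1, proj1_twist]
    rw [S.counit_mul, hx, zero_mul]
  · rw [proj1_twist hx, ← h2, proj1_twist (S.counit_d x)]

section

variable {A : TwoAsStr deg} {S : BStr deg}

lemma IsUnderlying.multGen_d (h : IsUnderlying A S) (x : T K V) :
    multGen K V (S.d x) = A.d (multGen K V x) := by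
  have key : ∀ x, counit K V x = 0 → multGen K V (S.d x) = A.d (multGen K V x) := by
    intro x hx
    rw [← proj1_twist (deg := deg) hx, ← h.d_eq x hx, proj1_twist (S.counit_d x)]
  have h1 := key (x - algebraMap K _ (counit K V x)) (by simp)
  simpa [Algebra.algebraMap_eq_smul_one, S.d_one, A.d_one] using h1

lemma IsUnderlying.multGen_mul (h : IsUnderlying A S) (x y : T K V) :
    multGen K V (S.mul x y) = A.bul (multGen K V x) (multGen K V y) := by
  have key : ∀ x y, counit K V x = 0 → counit K V y = 0 →
      multGen K V (S.mul x y) = A.bul (multGen K V x) (multGen K V y) := by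
    intro x y hx hy
    rw [← proj1_twist (deg := deg) hx, ← proj1_twist (deg := deg) hy, ← h.mul_eq x y hx hy,
      proj1_twist]
    rw [S.counit_mul, hx, zero_mul]
  have h1 := key (x - algebraMap K _ (counit K V x)) (y - algebraMap K _ (counit K V y))
    (by simp) (by simp)
  simp only [Algebra.algebraMap_eq_smul_one, map_sub, map_smul, LinearMap.sub_apply,
    LinearMap.smul_apply, S.one_mul, S.mul_one, map_one, A.one_bul, A.bul_one] at h1
  have h2 := congrArg (fun t => t + counit K V x • multGen K V y +
    counit K V y • multGen K V x - counit K V y • counit K V x • (1 : V)) h1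
  simp only [smul_sub] at h2
  have e1 : ∀ a b c e : V, a - b - (c - e) + b + c - e = a := fun _ _ _ _ => by abel
  rwa [e1, e1] at h2

end

lemma IsUnderlying.unique {A : TwoAsStr deg} {S S' : BStr deg} (h : IsUnderlying A S)
    (h' : IsUnderlying A S') : S = S' := by
  have hid : ∀ n, ∀ v ∈ deg n, (LinearMap.id : V →ₗ[K] V) v ∈ deg n := fun _ _ hv => hv
  apply BStr.ext'
  · ext1 x
    have := tmap_d_of (S := S') (S' := S) hid (multGen K V).toLinearMap
      (fun v hv => eq_zero_of_multGen hv)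
      (fun x => by simp [h.multGen_d, h'.multGen_d]) x
    simpa only [tmap_id] using this
  · refine LinearMap.ext₂ fun x y => ?_
    have := tmap_mul_of (S := S') (S' := S) hid (multGen K V).toLinearMap
      (fun v hv => eq_zero_of_multGen hv)
      (fun x y => by simp [h.multGen_mul, h'.multGen_mul]) x y
    simpa only [tmap_id] using this

/-- The underlying `B_∞` structure of a 2-associative differential algebra. -/
def underlying (A : TwoAsStr deg) : BStr deg := Classical.choose (exists_isUnderlying A)

lemma underlying_isUnderlying (A : TwoAsStr deg) : IsUnderlying A (underlying A) :=
  Classical.choose_spec (exists_isUnderlying A)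

end Underlying

/-- A `B_∞` algebra: a `ℤ`-graded vector space with a `B_∞` structure. -/
structure BInfAlg (K : Type u) [Field K] where
  carrier : Type u
  [addCommGroup : AddCommGroup carrier]
  [module : Module K carrier]
  deg : ℤ → Submodule K carrier
  [decomposition : Decomposition deg]
  str : BStr deg

/-- A 2-associative differential algebra: a `ℤ`-graded vector space with two associative
multiplications `∘` (the ring multiplication) and `•` with the same unit, and a differential of
degree `-1` which is a derivation of `•`. -/
structure TwoAsDGA (K : Type u) [Field K] where
  carrier : Type u
  [ring : Ring carrier]
  [algebra : Algebra K carrier]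
  deg : ℤ → Submodule K carrier
  [gradedAlgebra : GradedAlgebra deg]
  str : TwoAsStr deg

attribute [instance] BInfAlg.addCommGroup BInfAlg.module BInfAlg.decomposition
  TwoAsDGA.ring TwoAsDGA.algebra TwoAsDGA.gradedAlgebra

section Categories

variable {K : Type u} [Field K]

/-- A homomorphism of `B_∞` algebras: a linear map of degree `0` commuting with the operations
`m_n = p₁ d` on `n`-fold tensors and `m_{i,j} = p₁ μ` on pairs of an `i`-fold and a `j`-fold
tensor. -/
@[ext]
structure BInfAlg.Hom (A B : BInfAlg K) where
  lin : A.carrier →ₗ[K] B.carrier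
  map_deg : ∀ n, ∀ v ∈ A.deg n, lin v ∈ B.deg n
  map_d : ∀ x, lin (proj1 K _ (A.str.d x)) = proj1 K _ (B.str.d (tmap lin x))
  map_mul : ∀ x y,
    lin (proj1 K _ (A.str.mul x y)) = proj1 K _ (B.str.mul (tmap lin x) (tmap lin y))

/-- A homomorphism of 2-associative differential algebras: a linear map of degree `0` preserving
the unit, both multiplications and the differential. -/
@[ext]
structure TwoAsDGA.Hom (A B : TwoAsDGA K) where
  lin : A.carrier →ₗ[K] B.carrier
  map_deg : ∀ n, ∀ v ∈ A.deg n, lin v ∈ B.deg n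
  map_one : lin 1 = 1
  map_cir : ∀ x y, lin (x * y) = lin x * lin y
  map_bul : ∀ x y, lin (A.str.bul x y) = B.str.bul (lin x) (lin y)
  map_d : ∀ x, lin (A.str.d x) = B.str.d (lin x)

lemma BInfAlg.Hom.tmap_d {A B : BInfAlg K} (f : A.Hom B) (x : T K A.carrier) :
    B.str.d (tmap f.lin x) = tmap f.lin (A.str.d x) :=
  tmap_d_of f.map_deg (proj1 K B.carrier) (fun v h => by simpa using h)
    (fun x => by rw [proj1_tmap, f.map_d]) x

lemma BInfAlg.Hom.tmap_mul {A B : BInfAlg K} (f : A.Hom B) (x y : T K A.carrier) :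
    B.str.mul (tmap f.lin x) (tmap f.lin y) = tmap f.lin (A.str.mul x y) :=
  tmap_mul_of f.map_deg (proj1 K B.carrier) (fun v h => by simpa using h)
    (fun x y => by rw [proj1_tmap, f.map_mul]) x y

/-- The category of `B_∞` algebras. -/
instance : Category (BInfAlg K) where
  Hom A B := A.Hom B
  id A :=
    { lin := LinearMap.id
      map_deg := fun _ _ h => h
      map_d := fun x => by rw [tmap_id, LinearMap.id_apply]
      map_mul := fun x y => by rw [tmap_id, tmap_id, LinearMap.id_apply] }
  comp f g :=
    { lin := g.lin ∘ₗ f.lin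
      map_deg := fun n v h => g.map_deg n _ (f.map_deg n v h)
      map_d := fun x => by
        rw [LinearMap.comp_apply, f.map_d, g.map_d, tmap_comp]
      map_mul := fun x y => by
        rw [LinearMap.comp_apply, f.map_mul, g.map_mul, tmap_comp, tmap_comp] }

/-- The category of 2-associative differential algebras. -/
instance : Category (TwoAsDGA K) where
  Hom A B := A.Hom B
  id A :=
    { lin := LinearMap.id
      map_deg := fun _ _ h => h
      map_one := rfl
      map_cir := fun _ _ => rfl
      map_bul := fun _ _ => rfl
      map_d := fun _ => rfl }
  comp f g :=
    { lin := g.lin ∘ₗ f.lin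
      map_deg := fun n v h => g.map_deg n _ (f.map_deg n v h)
      map_one := by rw [LinearMap.comp_apply, f.map_one, g.map_one]
      map_cir := fun x y => by simp only [LinearMap.comp_apply, f.map_cir, g.map_cir]
      map_bul := fun x y => by simp only [LinearMap.comp_apply, f.map_bul, g.map_bul]
      map_d := fun x => by simp only [LinearMap.comp_apply, f.map_d, g.map_d] }

lemma BInfAlg.hom_ext {A B : BInfAlg K} {f g : A ⟶ B} (h : f.lin = g.lin) : f = g :=
  BInfAlg.Hom.ext h

lemma TwoAsDGA.hom_ext {A B : TwoAsDGA K} {f g : A ⟶ B} (h : f.lin = g.lin) : f = g :=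
  TwoAsDGA.Hom.ext h

@[simp] lemma BInfAlg.id_lin (A : BInfAlg K) : BInfAlg.Hom.lin (𝟙 A) = LinearMap.id := rfl
@[simp] lemma BInfAlg.comp_lin {A B C : BInfAlg K} (f : A ⟶ B) (g : B ⟶ C) :
    (f ≫ g).lin = g.lin ∘ₗ f.lin := rfl
@[simp] lemma TwoAsDGA.id_lin (A : TwoAsDGA K) : TwoAsDGA.Hom.lin (𝟙 A) = LinearMap.id := rfl
@[simp] lemma TwoAsDGA.comp_lin {A B C : TwoAsDGA K} (f : A ⟶ B) (g : B ⟶ C) :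
    (f ≫ g).lin = g.lin ∘ₗ f.lin := rfl

/-- The underlying `B_∞` algebra of a 2-associative differential algebra. -/
abbrev TwoAsDGA.toBInfAlg (V : TwoAsDGA K) : BInfAlg K where
  carrier := V.carrier
  deg := V.deg
  str := underlying V.str

lemma TwoAsDGA.Hom.multGen_tmap {V W : TwoAsDGA K} (f : V.Hom W) (x : T K V.carrier) :
    multGen K W.carrier (tmap f.lin x) = f.lin (multGen K V.carrier x) := by
  induction x using T_induction with
  | one => simp [f.map_one]
  | add x y hx hy => simp only [map_add, hx, hy]
  | smul c x hx => simp only [map_smul, hx]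
  | gen_mul v x hx => rw [map_mul, map_mul, map_mul, tmap_gen, hx, multGen_gen, multGen_gen,
      f.map_cir]

lemma TwoAsDGA.Hom.underlying_d {V W : TwoAsDGA K} (f : V.Hom W) (x : T K V.carrier) :
    (underlying W.str).d (tmap f.lin x) = tmap f.lin ((underlying V.str).d x) :=
  tmap_d_of f.map_deg (multGen K W.carrier).toLinearMap (fun v h => eq_zero_of_multGen h)
    (fun x => by
      simp only [AlgHom.toLinearMap_apply, (underlying_isUnderlying _).multGen_d, f.multGen_tmap,
        f.map_d]) x

lemma TwoAsDGA.Hom.underlying_mul {V W : TwoAsDGA K} (f : V.Hom W) (x y : T K V.carrier) :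
    (underlying W.str).mul (tmap f.lin x) (tmap f.lin y) =
      tmap f.lin ((underlying V.str).mul x y) :=
  tmap_mul_of f.map_deg (multGen K W.carrier).toLinearMap (fun v h => eq_zero_of_multGen h)
    (fun x y => by
      simp only [AlgHom.toLinearMap_apply, (underlying_isUnderlying _).multGen_mul,
        f.multGen_tmap, f.map_bul]) x y

variable (K) in
/-- The underlying `B_∞` algebra functor. -/
def underlyingFunctor : TwoAsDGA K ⥤ BInfAlg K where
  obj V := V.toBInfAlg
  map f :=
    { lin := f.lin
      map_deg := f.map_deg
      map_d := fun x => ((congrArg _ (f.underlying_d x)).trans (proj1_tmap _ _)).symm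
      map_mul := fun x y => ((congrArg _ (f.underlying_mul x y)).trans (proj1_tmap _ _)).symm }
  map_id _ := rfl
  map_comp _ _ := rfl

/-- The 2-associative differential algebra `(T^c(A), ∂, •, ∘)` of a `B_∞` algebra `A`: the
differential and `•` are the structure maps of `A`, and `∘` is concatenation of tensors. -/
abbrev BInfAlg.tensor (A : BInfAlg K) : TwoAsDGA K where
  carrier := T K A.carrier
  deg := tdeg A.deg
  str :=
    { bul := A.str.mul
      d := A.str.d
      bul_mem := A.str.mul_mem
      one_bul := A.str.one_mul
      bul_one := A.str.mul_one
      bul_assoc := A.str.mul_assoc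
      d_mem := A.str.d_mem
      d_d := A.str.d_d
      d_bul := A.str.d_mul }

variable (K) in
/-- The functor `A ↦ (T^c(A), ∂, •, ∘)`. -/
def tensorFunctor : BInfAlg K ⥤ TwoAsDGA K where
  obj A := A.tensor
  map f :=
    { lin := (tmap f.lin).toLinearMap
      map_deg := fun _ _ h => tmap_mem f.lin f.map_deg h
      map_one := map_one (tmap f.lin)
      map_cir := fun x y => map_mul (tmap f.lin) x y
      map_bul := fun x y => (f.tmap_mul x y).symm
      map_d := fun x => (f.tmap_d x).symm }
  map_id _ := TwoAsDGA.hom_ext (LinearMap.ext fun x => tmap_id x)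
  map_comp f g := TwoAsDGA.hom_ext (LinearMap.ext fun x => tmap_comp g.lin f.lin x)

end Categories

/-- A graded space with all the operations of a 2-associative differential algebra, subject to no
laws other than linearity and homogeneity. -/
structure PreAlg (K : Type u) [Field K] where
  carrier : Type u
  [addCommGroup : AddCommGroup carrier]
  [module : Module K carrier]
  deg : ℤ → Submodule K carrier
  [decomposition : Decomposition deg]
  one : carrier
  cir : carrier →ₗ[K] carrier →ₗ[K] carrier
  bul : carrier →ₗ[K] carrier →ₗ[K] carrier
  d : carrier →ₗ[K] carrier
  one_mem : one ∈ deg 0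
  cir_mem : ∀ (m n : ℤ) (x y : carrier), x ∈ deg m → y ∈ deg n → cir x y ∈ deg (m + n)
  bul_mem : ∀ (m n : ℤ) (x y : carrier), x ∈ deg m → y ∈ deg n → bul x y ∈ deg (m + n)
  d_mem : ∀ (n : ℤ) (x : carrier), x ∈ deg n → d x ∈ deg (n - 1)

attribute [instance] PreAlg.addCommGroup PreAlg.module PreAlg.decomposition

section Ideals

variable {K : Type u} [Field K]

/-- The operations of a 2-associative differential algebra. -/
abbrev TwoAsDGA.toPreAlg (V : TwoAsDGA K) : PreAlg K where
  carrier := V.carrier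
  deg := V.deg
  one := 1
  cir := LinearMap.mul K V.carrier
  bul := V.str.bul
  d := V.str.d
  one_mem := SetLike.GradedOne.one_mem
  cir_mem := fun _ _ _ _ hx hy => SetLike.GradedMul.mul_mem hx hy
  bul_mem := V.str.bul_mem
  d_mem := V.str.d_mem

namespace PreAlg

variable (P : PreAlg K)

/-- A graded two-sided ideal: a homogeneous subspace which absorbs both multiplications on both
sides and is stable under the differential. -/
structure IsIdeal (J : Submodule K P.carrier) : Prop where
  homogeneous : ∀ x ∈ J, ∀ n, (decompose P.deg x n : P.carrier) ∈ J
  cir_left : ∀ x, ∀ y ∈ J, P.cir x y ∈ J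
  cir_right : ∀ x ∈ J, ∀ y, P.cir x y ∈ J
  bul_left : ∀ x, ∀ y ∈ J, P.bul x y ∈ J
  bul_right : ∀ x ∈ J, ∀ y, P.bul x y ∈ J
  d_mem : ∀ x ∈ J, P.d x ∈ J

/-- The elements which have to vanish for the laws of a 2-associative differential algebra
to hold. -/
inductive LawRel : P.carrier → Prop
  | one_cir (x) : LawRel (P.cir P.one x - x)
  | cir_one (x) : LawRel (P.cir x P.one - x)
  | cir_assoc (x y z) : LawRel (P.cir (P.cir x y) z - P.cir x (P.cir y z))
  | one_bul (x) : LawRel (P.bul P.one x - x)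
  | bul_one (x) : LawRel (P.bul x P.one - x)
  | bul_assoc (x y z) : LawRel (P.bul (P.bul x y) z - P.bul x (P.bul y z))
  | d_d (x) : LawRel (P.d (P.d x))
  | d_bul (n x y) : x ∈ P.deg n →
      LawRel (P.d (P.bul x y) - (P.bul (P.d x) y + sg K n • P.bul x (P.d y)))

variable {P}

/-- The graded two-sided ideal generated by a set. -/
def idealSpan (s : Set P.carrier) : Submodule K P.carrier :=
  sInf {J | P.IsIdeal J ∧ s ⊆ J}

lemma subset_idealSpan (s : Set P.carrier) : s ⊆ idealSpan s := fun x hx => by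
  rw [SetLike.mem_coe, idealSpan, Submodule.mem_sInf]
  exact fun J hJ => hJ.2 hx

lemma idealSpan_le {s : Set P.carrier} {J : Submodule K P.carrier} (hJ : P.IsIdeal J)
    (h : s ⊆ J) : idealSpan s ≤ J := sInf_le ⟨hJ, h⟩

lemma idealSpan_isIdeal (s : Set P.carrier) : P.IsIdeal (idealSpan s) := by
  have key : ∀ {x}, x ∈ idealSpan s ↔ ∀ J, P.IsIdeal J ∧ s ⊆ J → x ∈ J := by
    intro x; rw [idealSpan, Submodule.mem_sInf]; rfl
  constructor
  · exact fun x hx n => key.2 fun J hJ => hJ.1.homogeneous x (key.1 hx J hJ) n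
  · exact fun x y hy => key.2 fun J hJ => hJ.1.cir_left x y (key.1 hy J hJ)
  · exact fun x hx y => key.2 fun J hJ => hJ.1.cir_right x (key.1 hx J hJ) y
  · exact fun x y hy => key.2 fun J hJ => hJ.1.bul_left x y (key.1 hy J hJ)
  · exact fun x hx y => key.2 fun J hJ => hJ.1.bul_right x (key.1 hx J hJ) y
  · exact fun x hx => key.2 fun J hJ => hJ.1.d_mem x (key.1 hx J hJ)

variable (P) in
/-- A graded ideal whose quotient satisfies the laws of a 2-associative differential algebra. -/
structure LawIdeal where
  sub : Submodule K P.carrier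
  isIdeal : P.IsIdeal sub
  law : ∀ x, P.LawRel x → x ∈ sub

namespace LawIdeal

variable (J : P.LawIdeal)

/-- The quotient by a graded ideal. -/
def Quo : Type u := P.carrier ⧸ J.sub

instance : AddCommGroup J.Quo := inferInstanceAs (AddCommGroup (P.carrier ⧸ J.sub))
instance : Module K J.Quo := inferInstanceAs (Module K (P.carrier ⧸ J.sub))

/-- The quotient map. -/
def cls : P.carrier →ₗ[K] J.Quo := J.sub.mkQ

lemma mk_surjective : Function.Surjective J.cls := J.sub.mkQ_surjective

lemma mk_eq_zero {x : P.carrier} : J.cls x = 0 ↔ x ∈ J.sub := Submodule.Quotient.mk_eq_zero _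

lemma mk_eq_mk {x y : P.carrier} (h : P.LawRel (x - y)) : J.cls x = J.cls y := by
  rw [← sub_eq_zero, ← map_sub, mk_eq_zero]
  exact J.law _ h

/-- A linear map on the quotient. -/
def lift {M : Type*} [AddCommGroup M] [Module K M] (f : P.carrier →ₗ[K] M)
    (h : ∀ x ∈ J.sub, f x = 0) : J.Quo →ₗ[K] M := J.sub.liftQ f h

@[simp] lemma lift_mk {M : Type*} [AddCommGroup M] [Module K M] (f : P.carrier →ₗ[K] M)
    (h : ∀ x ∈ J.sub, f x = 0) (x : P.carrier) : J.lift f h (J.cls x) = f x := rfl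

lemma hom_ext {M : Type*} [AddCommGroup M] [Module K M] {f g : J.Quo →ₗ[K] M}
    (h : ∀ x, f (J.cls x) = g (J.cls x)) : f = g := by
  ext x
  obtain ⟨x, rfl⟩ := J.mk_surjective x
  exact h x

/-- A bilinear operation on the quotient. -/
def lift₂ (f : P.carrier →ₗ[K] P.carrier →ₗ[K] P.carrier)
    (hl : ∀ x, ∀ y ∈ J.sub, f x y ∈ J.sub) (hr : ∀ x ∈ J.sub, ∀ y, f x y ∈ J.sub) :
    J.Quo →ₗ[K] J.Quo →ₗ[K] J.Quo :=
  J.lift (J.lift (f.compr₂ J.cls).flip fun y hy => LinearMap.ext fun x =>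
    J.mk_eq_zero.2 (hl x y hy)).flip fun x hx => J.hom_ext fun y => J.mk_eq_zero.2 (hr x hx y)

lemma lift₂_mk (f : P.carrier →ₗ[K] P.carrier →ₗ[K] P.carrier)
    (hl : ∀ x, ∀ y ∈ J.sub, f x y ∈ J.sub) (hr : ∀ x ∈ J.sub, ∀ y, f x y ∈ J.sub) (x y) :
    J.lift₂ f hl hr (J.cls x) (J.cls y) = J.cls (f x y) := rfl

/-- The multiplication `∘` of the quotient. -/
def cir : J.Quo →ₗ[K] J.Quo →ₗ[K] J.Quo := J.lift₂ P.cir J.isIdeal.cir_left J.isIdeal.cir_right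

/-- The multiplication `•` of the quotient. -/
def bul : J.Quo →ₗ[K] J.Quo →ₗ[K] J.Quo := J.lift₂ P.bul J.isIdeal.bul_left J.isIdeal.bul_right

/-- The differential of the quotient. -/
def d : J.Quo →ₗ[K] J.Quo := J.lift (J.cls ∘ₗ P.d) fun x hx =>
  J.mk_eq_zero.2 (J.isIdeal.d_mem x hx)

lemma cir_mk (x y) : J.cir (J.cls x) (J.cls y) = J.cls (P.cir x y) := rfl
lemma bul_mk (x y) : J.bul (J.cls x) (J.cls y) = J.cls (P.bul x y) := rfl
lemma d_mk (x) : J.d (J.cls x) = J.cls (P.d x) := rfl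

instance : Ring J.Quo :=
  { (inferInstance : AddCommGroup J.Quo) with
    mul := fun x y => J.cir x y
    one := J.cls P.one
    left_distrib := fun x y z => map_add (J.cir x) y z
    right_distrib := fun x y z => LinearMap.map_add₂ J.cir x y z
    zero_mul := fun x => LinearMap.map_zero₂ J.cir x
    mul_zero := fun x => map_zero (J.cir x)
    mul_assoc := fun x y z => by
      obtain ⟨x, rfl⟩ := J.mk_surjective x
      obtain ⟨y, rfl⟩ := J.mk_surjective y
      obtain ⟨z, rfl⟩ := J.mk_surjective z
      exact J.mk_eq_mk (.cir_assoc x y z)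
    one_mul := fun x => by
      obtain ⟨x, rfl⟩ := J.mk_surjective x
      exact J.mk_eq_mk (.one_cir x)
    mul_one := fun x => by
      obtain ⟨x, rfl⟩ := J.mk_surjective x
      exact J.mk_eq_mk (.cir_one x) }

lemma mk_one : J.cls P.one = 1 := rfl
lemma mk_mul (x y) : J.cls x * J.cls y = J.cls (P.cir x y) := rfl

instance : Algebra K J.Quo :=
  Algebra.ofModule (fun r x y => LinearMap.map_smul₂ J.cir r x y)
    (fun r x y => map_smul (J.cir x) r y)

/-- The grading of the quotient. -/
def deg (n : ℤ) : Submodule K J.Quo := (P.deg n).map J.cls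

lemma mk_mem {n : ℤ} {x : P.carrier} (hx : x ∈ P.deg n) : J.cls x ∈ J.deg n :=
  Submodule.mem_map_of_mem hx

/-- The homogeneous components of the class of an element. -/
def components : J.Quo →ₗ[K] ⨁ n, J.deg n :=
  J.lift (DirectSum.lmap (fun n => J.cls.restrict (p := P.deg n) (q := J.deg n)
    fun _ h => J.mk_mem h) ∘ₗ (decomposeLinearEquiv P.deg).toLinearMap) fun x hx => by
      apply DFinsupp.ext
      intro n
      apply Subtype.ext
      exact J.mk_eq_zero.2 (J.isIdeal.homogeneous x hx n)

lemma components_mk {n : ℤ} {x : P.carrier} (hx : x ∈ P.deg n) :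
    J.components (J.cls x) = lof K ℤ (fun i => J.deg i) n ⟨J.cls x, J.mk_mem hx⟩ := by
  simp only [components, lift_mk, LinearMap.comp_apply, LinearEquiv.coe_coe,
    decomposeLinearEquiv_of_mem P.deg hx, DirectSum.lmap_lof]
  rfl

instance : GradedAlgebra J.deg :=
  { Decomposition.ofLinearMap J.deg J.components
      (J.hom_ext fun x => by
        induction x using Decomposition.inductionOn P.deg with
        | zero => simp
        | add x y hx hy => simp only [map_add, hx, hy]
        | homogeneous m =>
          rw [LinearMap.comp_apply, components_mk J m.2, coeLinearMap_lof]
          rfl)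
      (by
        apply DirectSum.linearMap_ext
        intro n
        ext1 ⟨x, hx⟩
        obtain ⟨y, hy, rfl⟩ := hx
        simp only [LinearMap.comp_apply, coeLinearMap_lof, components_mk J hy]
        rfl) with
    one_mem := J.mk_mem P.one_mem
    mul_mem := by
      rintro i j _ _ ⟨x, hx, rfl⟩ ⟨y, hy, rfl⟩
      exact J.mk_mem (P.cir_mem i j x y hx hy) }

/-- The quotient, as a 2-associative differential algebra. -/
abbrev quotient : TwoAsDGA K where
  carrier := J.Quo
  deg := J.deg
  str :=
    { bul := J.bul
      d := J.d
      bul_mem := by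
        rintro i j _ _ ⟨x, hx, rfl⟩ ⟨y, hy, rfl⟩
        exact J.mk_mem (P.bul_mem i j x y hx hy)
      one_bul := fun x => by
        obtain ⟨x, rfl⟩ := J.mk_surjective x
        exact J.mk_eq_mk (.one_bul x)
      bul_one := fun x => by
        obtain ⟨x, rfl⟩ := J.mk_surjective x
        exact J.mk_eq_mk (.bul_one x)
      bul_assoc := fun x y z => by
        obtain ⟨x, rfl⟩ := J.mk_surjective x
        obtain ⟨y, rfl⟩ := J.mk_surjective y
        obtain ⟨z, rfl⟩ := J.mk_surjective z
        exact J.mk_eq_mk (.bul_assoc x y z)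
      d_mem := by
        rintro n _ ⟨x, hx, rfl⟩
        exact J.mk_mem (P.d_mem n x hx)
      d_d := fun x => by
        obtain ⟨x, rfl⟩ := J.mk_surjective x
        exact J.mk_eq_zero.2 (J.law _ (.d_d x))
      d_bul := by
        rintro n _ y ⟨x, hx, rfl⟩
        obtain ⟨y, rfl⟩ := J.mk_surjective y
        exact J.mk_eq_mk (.d_bul n x y hx) }

end LawIdeal

/-- A linear map of degree `0` from a space with operations to a 2-associative differential
algebra which preserves the operations. -/
structure IsHom (P : PreAlg K) (V : TwoAsDGA K) (f : P.carrier →ₗ[K] V.carrier) : Prop where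
  map_deg : ∀ n, ∀ v ∈ P.deg n, f v ∈ V.deg n
  map_one : f P.one = 1
  map_cir : ∀ x y, f (P.cir x y) = f x * f y
  map_bul : ∀ x y, f (P.bul x y) = V.str.bul (f x) (f y)
  map_d : ∀ x, f (P.d x) = V.str.d (f x)

namespace IsHom

variable {V : TwoAsDGA K} {f : P.carrier →ₗ[K] V.carrier}

lemma map_decompose (hf : P.IsHom V f) (x : P.carrier) (n : ℤ) :
    f (decompose P.deg x n) = decompose V.deg (f x) n := by
  induction x using Decomposition.inductionOn P.deg with
  | zero => simp
  | add x y hx hy => simp [decompose_add, map_add, hx, hy]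
  | homogeneous m =>
    rename_i i
    by_cases h : i = n
    · subst h
      rw [decompose_of_mem_same _ m.2, decompose_of_mem_same _ (hf.map_deg _ _ m.2)]
    · rw [decompose_of_mem_ne _ m.2 h, decompose_of_mem_ne _ (hf.map_deg _ _ m.2) h, map_zero]

lemma isIdeal_ker (hf : P.IsHom V f) : P.IsIdeal (LinearMap.ker f) where
  homogeneous x hx n := by
    rw [LinearMap.mem_ker] at hx ⊢
    rw [hf.map_decompose, hx]
    simp
  cir_left x y hy := by
    rw [LinearMap.mem_ker] at hy ⊢
    rw [hf.map_cir, hy, mul_zero]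
  cir_right x hx y := by
    rw [LinearMap.mem_ker] at hx ⊢
    rw [hf.map_cir, hx, zero_mul]
  bul_left x y hy := by
    rw [LinearMap.mem_ker] at hy ⊢
    rw [hf.map_bul, hy, map_zero]
  bul_right x hx y := by
    rw [LinearMap.mem_ker] at hx ⊢
    rw [hf.map_bul, hx, map_zero, LinearMap.zero_apply]
  d_mem x hx := by
    rw [LinearMap.mem_ker] at hx ⊢
    rw [hf.map_d, hx, map_zero]

lemma law_ker (hf : P.IsHom V f) (x : P.carrier) (h : P.LawRel x) : f x = 0 := by
  cases h with
  | one_cir x => rw [map_sub, hf.map_cir, hf.map_one, one_mul, sub_self]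
  | cir_one x => rw [map_sub, hf.map_cir, hf.map_one, mul_one, sub_self]
  | cir_assoc x y z => rw [map_sub, hf.map_cir, hf.map_cir, hf.map_cir, hf.map_cir, mul_assoc,
      sub_self]
  | one_bul x => rw [map_sub, hf.map_bul, hf.map_one, V.str.one_bul, sub_self]
  | bul_one x => rw [map_sub, hf.map_bul, hf.map_one, V.str.bul_one, sub_self]
  | bul_assoc x y z => rw [map_sub, hf.map_bul, hf.map_bul, hf.map_bul, hf.map_bul,
      V.str.bul_assoc, sub_self]
  | d_d x => rw [hf.map_d, hf.map_d, V.str.d_d]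
  | d_bul n x y hx =>
    rw [map_sub, hf.map_d, hf.map_bul, V.str.d_bul n _ _ (hf.map_deg n x hx), map_add, map_smul,
      hf.map_bul, hf.map_bul, hf.map_d, hf.map_d, sub_self]

/-- The homomorphism on a quotient. -/
def desc (hf : P.IsHom V f) (J : P.LawIdeal) (h : ∀ x ∈ J.sub, f x = 0) : J.quotient ⟶ V where
  lin := J.lift f h
  map_deg := by
    rintro n _ ⟨x, hx, rfl⟩
    exact hf.map_deg n x hx
  map_one := hf.map_one
  map_cir x y := by
    obtain ⟨x, rfl⟩ := J.mk_surjective x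
    obtain ⟨y, rfl⟩ := J.mk_surjective y
    exact hf.map_cir x y
  map_bul x y := by
    obtain ⟨x, rfl⟩ := J.mk_surjective x
    obtain ⟨y, rfl⟩ := J.mk_surjective y
    exact hf.map_bul x y
  map_d x := by
    obtain ⟨x, rfl⟩ := J.mk_surjective x
    exact hf.map_d x

end IsHom

lemma LawIdeal.mk_isHom (J : P.LawIdeal) : P.IsHom J.quotient J.cls where
  map_deg _ _ h := J.mk_mem h
  map_one := rfl
  map_cir _ _ := rfl
  map_bul _ _ := rfl
  map_d _ := rfl

end PreAlg

end Ideals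

section Free

variable {K : Type u} [Field K]

section Terms

variable {V : Type u} [AddCommGroup V] [Module K V] (deg : ℤ → Submodule K V)

/-- Formal expressions in homogeneous elements of `V`, built from a unit, two binary operations
and a unary operation. -/
inductive Formal : Type u
  | letter (a : Letter deg)
  | one
  | cir (s t : Formal)
  | bul (s t : Formal)
  | d (t : Formal)

variable {deg} in
/-- The degree of a formal expression. -/
def Formal.degree : Formal deg → ℤ
  | letter a => a.1
  | one => 0
  | cir s t => s.degree + t.degree
  | bul s t => s.degree + t.degree
  | d t => t.degree - 1

/-- Linear combinations of formal expressions of degree `n`. -/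
def termDeg (n : ℤ) : Submodule K (Formal deg →₀ K) :=
  Submodule.span K {x | ∃ t : Formal deg, t.degree = n ∧ Finsupp.single t 1 = x}

variable {deg}

/-- The formal expression `t`, as a linear combination. -/
abbrev term (t : Formal deg) : Formal deg →₀ K := Finsupp.single t 1

lemma term_mem_of_eq {t : Formal deg} {n : ℤ} (h : t.degree = n) : term t ∈ termDeg deg n :=
  Submodule.subset_span ⟨t, h, rfl⟩

lemma term_hom_ext {M : Type*} [AddCommMonoid M] [Module K M] {f g : (Formal deg →₀ K) →ₗ[K] M}
    (h : ∀ t, f (term t) = g (term t)) : f = g :=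
  Finsupp.lhom_ext' fun t => LinearMap.ext_ring (h t)

/-- The linear map with given values on formal expressions. -/
def termLift {M : Type*} [AddCommMonoid M] [Module K M] (f : Formal deg → M) :
    (Formal deg →₀ K) →ₗ[K] M := Finsupp.linearCombination K f

@[simp] lemma termLift_term {M : Type*} [AddCommMonoid M] [Module K M] (f : Formal deg → M)
    (t : Formal deg) : termLift (K := K) f (term t) = f t := by simp [termLift]

instance : Decomposition (termDeg deg) :=
  Decomposition.ofLinearMap _
    (termLift fun t => lof K ℤ (fun i => termDeg deg i) t.degree ⟨term t, term_mem_of_eq rfl⟩)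
    (term_hom_ext fun t => by
      rw [LinearMap.comp_apply, termLift_term, coeLinearMap_lof, LinearMap.id_apply])
    (by
      apply DirectSum.linearMap_ext
      intro n
      ext1 ⟨x, hx⟩
      simp only [LinearMap.comp_apply, coeLinearMap_lof, LinearMap.id_apply]
      induction hx using Submodule.span_induction with
      | mem x hx =>
        obtain ⟨t, rfl, rfl⟩ := hx
        exact termLift_term _ t
      | zero => rw [map_zero]; exact (map_zero _).symm
      | add x y hx hy h1 h2 => rw [map_add, h1, h2, ← map_add]; rfl
      | smul c x hx h => rw [map_smul, h, ← map_smul]; rfl)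

/-- The bilinear extension of a binary operation on formal expressions. -/
def termOp (f : Formal deg → Formal deg → Formal deg) :
    (Formal deg →₀ K) →ₗ[K] (Formal deg →₀ K) →ₗ[K] (Formal deg →₀ K) :=
  termLift fun s => termLift fun t => term (f s t)

lemma termOp_term (f : Formal deg → Formal deg → Formal deg) (s t : Formal deg) :
    termOp (K := K) f (term s) (term t) = term (f s t) := by
  rw [termOp, termLift_term, termLift_term]

lemma termOp_mem (f : Formal deg → Formal deg → Formal deg)
    (hf : ∀ s t, (f s t).degree = s.degree + t.degree) (m n : ℤ) (x y : Formal deg →₀ K)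
    (hx : x ∈ termDeg deg m) (hy : y ∈ termDeg deg n) : termOp f x y ∈ termDeg deg (m + n) := by
  induction hx, hy using Submodule.span_induction₂ with
  | mem_mem x y hx hy =>
    obtain ⟨s, rfl, rfl⟩ := hx
    obtain ⟨t, rfl, rfl⟩ := hy
    rw [termOp_term]
    exact term_mem_of_eq (hf s t)
  | zero_left => simp
  | zero_right => simp
  | add_left x y z _ _ _ h1 h2 => rw [LinearMap.map_add₂]; exact add_mem h1 h2
  | add_right x y z _ _ _ h1 h2 => rw [map_add]; exact add_mem h1 h2
  | smul_left r x y _ _ h => rw [LinearMap.map_smul₂]; exact Submodule.smul_mem _ _ h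
  | smul_right r x y _ _ h => rw [map_smul]; exact Submodule.smul_mem _ _ h

variable (deg) in
/-- Linear combinations of formal expressions, with the formal operations. -/
abbrev termPreAlg : PreAlg K where
  carrier := Formal deg →₀ K
  deg := termDeg deg
  one := term .one
  cir := termOp .cir
  bul := termOp .bul
  d := termLift fun t => term (.d t)
  one_mem := term_mem_of_eq rfl
  cir_mem := termOp_mem _ fun _ _ => rfl
  bul_mem := termOp_mem _ fun _ _ => rfl
  d_mem n x hx := by
    induction hx using Submodule.span_induction with
    | mem x hx =>
      obtain ⟨t, rfl, rfl⟩ := hx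
      rw [termLift_term]
      exact term_mem_of_eq rfl
    | zero => simp
    | add x y _ _ hx hy => rw [map_add]; exact add_mem hx hy
    | smul c x _ hx => rw [map_smul]; exact Submodule.smul_mem _ _ hx

variable (deg) in
/-- The relations of the free 2-associative differential algebra: linearity of the inclusion of
the generators, and the laws of a 2-associative differential algebra. -/
inductive FreeRel : (termPreAlg deg).carrier → Prop
  | add (n : ℤ) (a b : deg n) : FreeRel
      (term (.letter ⟨n, a + b⟩) - (term (.letter ⟨n, a⟩) + term (.letter ⟨n, b⟩)))
  | smul (n : ℤ) (c : K) (a : deg n) : FreeRel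
      (term (.letter ⟨n, c • a⟩) - c • term (.letter ⟨n, a⟩))
  | law (x) : (termPreAlg deg).LawRel x → FreeRel x

variable (deg) in
/-- The ideal defining the free 2-associative differential algebra. -/
def freeIdeal : (termPreAlg deg).LawIdeal where
  sub := PreAlg.idealSpan {x | FreeRel deg x}
  isIdeal := PreAlg.idealSpan_isIdeal _
  law x hx := PreAlg.subset_idealSpan _ (.law x hx)

variable (deg) in
/-- The free 2-associative differential algebra on a graded space. -/
abbrev freeTwoAs : TwoAsDGA K := (freeIdeal deg).quotient

variable (deg) in
/-- The inclusion of the homogeneous generators of degree `n`. -/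
def freeGen (n : ℤ) : deg n →ₗ[K] (freeTwoAs deg).carrier where
  toFun a := (freeIdeal deg).cls (term (.letter ⟨n, a⟩))
  map_add' a b := by
    refine sub_eq_zero.1 (((freeIdeal deg).mk_eq_zero (x := _)).2
      (PreAlg.subset_idealSpan _ (FreeRel.add n a b)))
  map_smul' c a := by
    refine sub_eq_zero.1 (((freeIdeal deg).mk_eq_zero (x := _)).2
      (PreAlg.subset_idealSpan _ (FreeRel.smul n c a)))

variable (deg) in
/-- The inclusion `α` of a graded space into the free 2-associative differential algebra. -/
def freeIncl [Decomposition deg] : V →ₗ[K] (freeTwoAs deg).carrier :=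
  toModule K ℤ _ (freeGen deg) ∘ₗ (decomposeLinearEquiv deg).toLinearMap

lemma freeIncl_of_mem [Decomposition deg] {n : ℤ} {a : V} (ha : a ∈ deg n) :
    freeIncl deg a = (freeIdeal deg).cls (term (.letter ⟨n, a, ha⟩)) := by
  rw [freeIncl, LinearMap.comp_apply, LinearEquiv.coe_coe, decomposeLinearEquiv_of_mem deg ha,
    toModule_lof]
  rfl

lemma freeIncl_mem [Decomposition deg] (n : ℤ) (a : V) (ha : a ∈ deg n) :
    freeIncl deg a ∈ (freeTwoAs deg).deg n := by
  rw [freeIncl_of_mem ha]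
  exact (freeIdeal deg).mk_mem (term_mem_of_eq rfl)

section Lift

variable (W : TwoAsDGA K) (f : V →ₗ[K] W.carrier)

/-- The value of a formal expression in a 2-associative differential algebra. -/
def Formal.eval : Formal deg → W.carrier
  | letter a => f a.2
  | one => 1
  | cir s t => Formal.eval s * Formal.eval t
  | bul s t => W.str.bul (Formal.eval s) (Formal.eval t)
  | d t => W.str.d (Formal.eval t)

variable {f}

lemma Formal.eval_mem (hf : ∀ n, ∀ v ∈ deg n, f v ∈ W.deg n) (t : Formal deg) :
    t.eval W f ∈ W.deg t.degree := by
  induction t with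
  | letter a => exact hf _ _ a.2.2
  | one => exact SetLike.GradedOne.one_mem
  | cir s t hs ht => exact SetLike.GradedMul.mul_mem hs ht
  | bul s t hs ht => exact W.str.bul_mem _ _ _ _ hs ht
  | d t ht => exact W.str.d_mem _ _ ht

lemma term_isHom (hf : ∀ n, ∀ v ∈ deg n, f v ∈ W.deg n) :
    (termPreAlg deg).IsHom W (termLift (Formal.eval W f)) where
  map_deg n x hx := by
    induction hx using Submodule.span_induction with
    | mem x hx =>
      obtain ⟨t, rfl, rfl⟩ := hx
      rw [termLift_term]
      exact t.eval_mem W hf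
    | zero => simp
    | add x y _ _ hx hy => rw [map_add]; exact add_mem hx hy
    | smul c x _ hx => rw [map_smul]; exact Submodule.smul_mem _ _ hx
  map_one := termLift_term _ _
  map_cir x y := by
    have h : (termOp Formal.cir).compr₂ (termLift (Formal.eval W f)) =
        (LinearMap.mul K W.carrier).compl₁₂ (termLift (Formal.eval W f))
          (termLift (Formal.eval (deg := deg) W f)) := by
      refine term_hom_ext fun s => term_hom_ext fun t => ?_
      rw [LinearMap.compr₂_apply, LinearMap.compl₁₂_apply, termOp_term, termLift_term,
        termLift_term, termLift_term]
      rfl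
    exact LinearMap.congr_fun₂ h x y
  map_bul x y := by
    have h : (termOp Formal.bul).compr₂ (termLift (Formal.eval W f)) =
        W.str.bul.compl₁₂ (termLift (Formal.eval W f))
          (termLift (Formal.eval (deg := deg) W f)) := by
      refine term_hom_ext fun s => term_hom_ext fun t => ?_
      rw [LinearMap.compr₂_apply, LinearMap.compl₁₂_apply, termOp_term, termLift_term,
        termLift_term, termLift_term]
      rfl
    exact LinearMap.congr_fun₂ h x y
  map_d x := by
    have h : termLift (Formal.eval W f) ∘ₗ (termLift fun t => term (.d t)) =
        W.str.d ∘ₗ termLift (Formal.eval (deg := deg) W f) := by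
      refine term_hom_ext fun t => ?_
      rw [LinearMap.comp_apply, LinearMap.comp_apply, termLift_term, termLift_term, termLift_term]
      rfl
    exact LinearMap.congr_fun h x

/-- The extension of a linear map of degree `0` to the free 2-associative differential algebra. -/
def freeLift (f : V →ₗ[K] W.carrier) (hf : ∀ n, ∀ v ∈ deg n, f v ∈ W.deg n) :
    freeTwoAs deg ⟶ W :=
  (term_isHom W hf).desc (freeIdeal deg) fun x hx => by
    refine PreAlg.idealSpan_le (term_isHom W hf).isIdeal_ker ?_ hx
    intro x hx
    rw [SetLike.mem_coe, LinearMap.mem_ker]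
    cases hx with
    | add n a b =>
      rw [map_sub, map_add, termLift_term, termLift_term, termLift_term]
      simp [Formal.eval]
    | smul n c a =>
      rw [map_sub, map_smul, termLift_term, termLift_term]
      simp [Formal.eval]
    | law x hx => exact (term_isHom W hf).law_ker x hx

lemma freeLift_incl [Decomposition deg] (hf : ∀ n, ∀ v ∈ deg n, f v ∈ W.deg n) (a : V) :
    (freeLift W f hf).lin (freeIncl deg a) = f a := by
  induction a using Decomposition.inductionOn deg with
  | zero => simp
  | add x y hx hy => simp only [map_add, hx, hy]
  | homogeneous m =>
    rw [freeIncl_of_mem m.2]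
    exact termLift_term _ _

lemma free_hom_ext [Decomposition deg] {W : TwoAsDGA K} {g h : freeTwoAs deg ⟶ W}
    (H : ∀ a, g.lin (freeIncl deg a) = h.lin (freeIncl deg a)) : g = h := by
  apply TwoAsDGA.hom_ext
  refine (freeIdeal deg).hom_ext fun x => ?_
  have h1 : g.lin ∘ₗ (freeIdeal deg).cls = h.lin ∘ₗ (freeIdeal deg).cls := by
    refine term_hom_ext fun t => ?_
    rw [LinearMap.comp_apply, LinearMap.comp_apply]
    induction t with
    | letter a =>
      have := H a.2
      rwa [freeIncl_of_mem a.2.2] at this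
    | one => exact g.map_one.trans h.map_one.symm
    | cir s t hs ht =>
      have e : (freeIdeal deg).cls (term (.cir s t)) =
          (freeIdeal deg).cls (term s) * (freeIdeal deg).cls (term t) := by
        rw [PreAlg.LawIdeal.mk_mul]
        exact congrArg _ (termOp_term _ s t).symm
      rw [e]
      exact (g.map_cir _ _).trans ((congrArg₂ _ hs ht).trans (h.map_cir _ _).symm)
    | bul s t hs ht =>
      have e : (freeIdeal deg).cls (term (.bul s t)) =
          (freeTwoAs deg).str.bul ((freeIdeal deg).cls (term s))
            ((freeIdeal deg).cls (term t)) :=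
        congrArg (freeIdeal deg).cls (termOp_term _ s t).symm
      rw [e]
      refine (g.map_bul _ _).trans (Eq.trans ?_ (h.map_bul _ _).symm)
      rw [hs, ht]
    | d t ht =>
      have e : (freeIdeal deg).cls (term (.d t)) =
          (freeTwoAs deg).str.d ((freeIdeal deg).cls (term t)) :=
        congrArg (freeIdeal deg).cls (termLift_term (fun t => term (Formal.d t)) t).symm
      rw [e]
      refine (g.map_d _).trans (Eq.trans ?_ (h.map_d _).symm)
      rw [ht]
  exact LinearMap.congr_fun h1 x

end Lift

end Terms

section Enveloping

variable (A : BInfAlg K)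

/-- The elements of the free 2-associative differential algebra on `A` expressing that the
inclusion `α` fails to commute with the operations `m_{i,j} = p₁ μ` and `m_n = p₁ d`; those for
`i = 0`, `j = 0` or `n = 0` are zero. -/
inductive EnvRel : (freeTwoAs A.deg).carrier → Prop
  | mul (x y : T K A.carrier) : EnvRel (freeIncl A.deg (proj1 K _ (A.str.mul x y)) -
      proj1 K _ ((underlying (freeTwoAs A.deg).str).mul (tmap (freeIncl A.deg) x)
        (tmap (freeIncl A.deg) y)))
  | d (x : T K A.carrier) : EnvRel (freeIncl A.deg (proj1 K _ (A.str.d x)) -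
      proj1 K _ ((underlying (freeTwoAs A.deg).str).d (tmap (freeIncl A.deg) x)))

/-- The ideal defining the universal enveloping 2-associative differential algebra. -/
def envIdeal : (freeTwoAs A.deg).toPreAlg.LawIdeal where
  sub := PreAlg.idealSpan {x | EnvRel A x}
  isIdeal := PreAlg.idealSpan_isIdeal _
  law x hx := by
    have h : (freeTwoAs A.deg).toPreAlg.IsHom (freeTwoAs A.deg) LinearMap.id :=
      ⟨fun _ _ h => h, rfl, fun _ _ => rfl, fun _ _ => rfl, fun _ => rfl⟩
    have h0 : x = 0 := h.law_ker x hx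
    rw [h0]
    exact zero_mem _

/-- The universal enveloping 2-associative differential algebra `U(A) = F(A) / I`. -/
abbrev env : TwoAsDGA K := (envIdeal A).quotient

/-- The projection `F(A) → U(A)`. -/
def envProj : freeTwoAs A.deg ⟶ env A where
  lin := (envIdeal A).cls
  map_deg := (envIdeal A).mk_isHom.map_deg
  map_one := rfl
  map_cir _ _ := rfl
  map_bul _ _ := rfl
  map_d _ := rfl

/-- The natural homomorphism of `B_∞` algebras from `A` to the underlying `B_∞` algebra
of `U(A)`. -/
def envUnit : A ⟶ (env A).toBInfAlg where
  lin := (envProj A).lin ∘ₗ freeIncl A.deg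
  map_deg n a ha := (envProj A).map_deg n _ (freeIncl_mem n a ha)
  map_d x := by
    rw [tmap_comp, LinearMap.comp_apply]
    refine Eq.trans ?_ (congrArg (proj1 K _) ((envProj A).underlying_d _)).symm
    refine Eq.trans ?_ (proj1_tmap _ _).symm
    rw [← sub_eq_zero, ← map_sub]
    exact (envIdeal A).mk_eq_zero.2 (PreAlg.subset_idealSpan _ (.d x))
  map_mul x y := by
    rw [tmap_comp, tmap_comp, LinearMap.comp_apply]
    refine Eq.trans ?_ (congrArg (proj1 K _) ((envProj A).underlying_mul _ _)).symm
    refine Eq.trans ?_ (proj1_tmap _ _).symm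
    rw [← sub_eq_zero, ← map_sub]
    exact (envIdeal A).mk_eq_zero.2 (PreAlg.subset_idealSpan _ (.mul x y))

variable {A}

/-- The homomorphism from `U(A)` determined by a homomorphism of `B_∞` algebras. -/
def envLift {W : TwoAsDGA K} (f : A ⟶ W.toBInfAlg) : env A ⟶ W :=
  let g : freeTwoAs A.deg ⟶ W := freeLift W f.lin f.map_deg
  have hg : (freeTwoAs A.deg).toPreAlg.IsHom W g.lin :=
    ⟨g.map_deg, g.map_one, g.map_cir, g.map_bul, g.map_d⟩
  hg.desc (envIdeal A) fun x hx => by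
    have h1 : g.lin ∘ₗ freeIncl A.deg = f.lin :=
      LinearMap.ext fun a => freeLift_incl W f.map_deg a
    refine PreAlg.idealSpan_le hg.isIdeal_ker ?_ hx
    rintro _ (⟨x, y⟩ | ⟨x⟩)
    · rw [SetLike.mem_coe, LinearMap.mem_ker]
      refine (map_sub g.lin _ _).trans (sub_eq_zero.2 ?_)
      refine (LinearMap.congr_fun h1 _).trans ((f.map_mul x y).trans ?_)
      rw [← proj1_tmap g.lin, ← g.underlying_mul, ← tmap_comp, ← tmap_comp, h1]
    · rw [SetLike.mem_coe, LinearMap.mem_ker]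
      refine (map_sub g.lin _ _).trans (sub_eq_zero.2 ?_)
      refine (LinearMap.congr_fun h1 _).trans ((f.map_d x).trans ?_)
      rw [← proj1_tmap g.lin, ← g.underlying_d, ← tmap_comp, h1]

lemma envLift_unit {W : TwoAsDGA K} (f : A ⟶ W.toBInfAlg) (a : A.carrier) :
    (envLift f).lin ((envUnit A).lin a) = f.lin a :=
  freeLift_incl W f.map_deg a

lemma env_hom_ext {W : TwoAsDGA K} {g h : env A ⟶ W}
    (H : ∀ a, g.lin ((envUnit A).lin a) = h.lin ((envUnit A).lin a)) : g = h := by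
  have h1 : envProj A ≫ g = envProj A ≫ h := free_hom_ext H
  apply TwoAsDGA.hom_ext
  exact (envIdeal A).hom_ext fun x => LinearMap.congr_fun (congrArg TwoAsDGA.Hom.lin h1) x

variable (K) in
/-- The universal enveloping functor: `U(f)` is the homomorphism determined by `f` followed by
the natural homomorphism `B → U(B)`. -/
def envFunctor : BInfAlg K ⥤ TwoAsDGA K where
  obj A := env A
  map f := envLift (f ≫ envUnit _)
  map_id A := env_hom_ext fun a => envLift_unit _ a
  map_comp f g := env_hom_ext fun a => by
    rw [envLift_unit, TwoAsDGA.comp_lin, LinearMap.comp_apply, envLift_unit]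
    exact (envLift_unit (g ≫ envUnit _) (f.lin a)).symm

end Enveloping

end Free

end BInfinity

end

/-!
Multiplication of tensors `m : v₁ ⊗ ⋯ ⊗ vₙ ↦ v₁ ∘ ⋯ ∘ vₙ` (`multGen`) equals `p̃₁ τ`, and the
underlying `B_∞` structure `(d, μ)` of a 2-associative differential algebra `V` is characterized by
`m d = ∂ m` and `m μ = m • m`. Since `m` also carries concatenation to `∘`, it is a homomorphism
`T^c(V) → V` of 2-associative differential algebras; this is the counit (`tensorCounit`).

For the unit, let `A` be a `B_∞` algebra. The composite of `T(ι₁) : T(A) → T(T(A))` with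
multiplication of tensors in `T(A)` is the identity. Hence `T(ι₁)` intertwines the structure of `A`
with the underlying structure of `T^c(A)` after applying `m`, and a map of tensor coalgebras is
determined by its composite with a map that is injective on generators (`tmap_d_of`, `tmap_mul_of`).
So `ι₁` is a homomorphism of `B_∞` algebras (`tensorUnit`). The triangle identities are
`m T(ι₁) = id` and `m ι₁ = id`.

Both `U(A)` and `T^c(A)` are thus universal among homomorphisms of `B_∞` algebras from `A` to
underlying `B_∞` algebras of 2-associative differential algebras, which gives the natural
isomorphism (`envIsoTensor`).
-/

namespace BInfinity

variable {K : Type u} [Field K]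

lemma multGen_mem {V : Type*} [Ring V] [Algebra K V] {deg : ℤ → Submodule K V}
    [GradedAlgebra deg] {n : ℤ} {x : T K V} (hx : x ∈ tdeg deg n) : multGen K V x ∈ deg n := by
  induction hx using Submodule.span_induction with
  | mem x hx => obtain ⟨l, rfl, rfl⟩ := hx; exact multGen_word_mem l
  | zero => simp
  | add x y _ _ hx hy => rw [map_add]; exact add_mem hx hy
  | smul c x _ hx => rw [map_smul]; exact Submodule.smul_mem _ _ hx

lemma multGen_tmap_gen {A : Type*} [AddCommGroup A] [Module K A] (x : T K A) :
    multGen K (T K A) (tmap (gen K A) x) = x := by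
  induction x using T_induction with
  | one => simp
  | add x y hx hy => simp only [map_add, hx, hy]
  | smul c x hx => simp only [map_smul, hx]
  | gen_mul v x hx => rw [map_mul, map_mul, hx, tmap_gen, multGen_gen]

/-- Multiplication of tensors `v₁ ⊗ ⋯ ⊗ vₙ ↦ v₁ ∘ ⋯ ∘ vₙ`, as a homomorphism `T^c(V) → V` of
2-associative differential algebras. -/
noncomputable def tensorCounit (V : TwoAsDGA K) : V.toBInfAlg.tensor ⟶ V where
  lin := (multGen K V.carrier).toLinearMap
  map_deg _ _ h := multGen_mem h
  map_one := map_one (multGen K V.carrier)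
  map_cir x y := map_mul (multGen K V.carrier) x y
  map_bul x y := (underlying_isUnderlying V.str).multGen_mul x y
  map_d x := (underlying_isUnderlying V.str).multGen_d x

/-- The inclusion `ι₁` of the generators, as a homomorphism of `B_∞` algebras from `A` to the
underlying `B_∞` algebra of `T^c(A)`. -/
noncomputable def tensorUnit (A : BInfAlg K) : A ⟶ A.tensor.toBInfAlg where
  lin := gen K A.carrier
  map_deg _ _ h := gen_mem h
  map_d x := by
    have h := tmap_d_of (S := A.str) (S' := underlying A.tensor.str) (f := gen K A.carrier)
      (fun _ _ h => gen_mem h) (multGen K (T K A.carrier)).toLinearMap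
      (fun _ h => eq_zero_of_multGen h) (fun x => by
        rw [AlgHom.toLinearMap_apply, AlgHom.toLinearMap_apply,
          (underlying_isUnderlying _).multGen_d, multGen_tmap_gen, multGen_tmap_gen]) x
    exact ((congrArg (proj1 K _) h).trans (proj1_tmap _ _)).symm
  map_mul x y := by
    have h := tmap_mul_of (S := A.str) (S' := underlying A.tensor.str) (f := gen K A.carrier)
      (fun _ _ h => gen_mem h) (multGen K (T K A.carrier)).toLinearMap
      (fun _ h => eq_zero_of_multGen h) (fun x y => by
        rw [AlgHom.toLinearMap_apply, AlgHom.toLinearMap_apply,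
          (underlying_isUnderlying _).multGen_mul, multGen_tmap_gen, multGen_tmap_gen,
          multGen_tmap_gen]) x y
    exact ((congrArg (proj1 K _) h).trans (proj1_tmap _ _)).symm

variable (K) in
/-- The adjunction between `T^c` and the underlying `B_∞` algebra functor. -/
noncomputable def tensorAdjunction : tensorFunctor K ⊣ underlyingFunctor K :=
  Adjunction.mkOfUnitCounit
    { unit :=
        { app := tensorUnit
          naturality := fun _ _ f => BInfAlg.hom_ext
            (LinearMap.ext fun a => (tmap_gen f.lin a).symm) }
      counit :=
        { app := tensorCounit
          naturality := fun _ _ f => TwoAsDGA.hom_ext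
            (LinearMap.ext fun x => f.multGen_tmap x) }
      left_triangle := by
        ext A : 2
        exact TwoAsDGA.hom_ext (LinearMap.ext fun x => multGen_tmap_gen x)
      right_triangle := by
        ext V : 2
        exact BInfAlg.hom_ext (LinearMap.ext fun v => multGen_gen (V := V.carrier) v) }

lemma tensor_hom_ext {A : BInfAlg K} {W : TwoAsDGA K} {g h : A.tensor ⟶ W}
    (H : ∀ a, g.lin (gen K A.carrier a) = h.lin (gen K A.carrier a)) : g = h :=
  ((tensorAdjunction K).homEquiv A W).injective (BInfAlg.hom_ext (LinearMap.ext H))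

/-- The homomorphism from `T^c(A)` determined by a homomorphism of `B_∞` algebras. -/
noncomputable def tensorLift {A : BInfAlg K} {W : TwoAsDGA K} (f : A ⟶ W.toBInfAlg) :
    A.tensor ⟶ W :=
  (tensorFunctor K).map f ≫ tensorCounit W

lemma tensorLift_gen {A : BInfAlg K} {W : TwoAsDGA K} (f : A ⟶ W.toBInfAlg) (a : A.carrier) :
    (tensorLift f).lin (gen K A.carrier a) = f.lin a :=
  (congrArg (multGen K W.carrier) (tmap_gen f.lin a)).trans (multGen_gen _)

variable (K) in
/-- The natural isomorphism `U ≅ T^c`, obtained from the two universal properties. -/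
noncomputable def envIsoTensor : envFunctor K ≅ tensorFunctor K :=
  NatIso.ofComponents
    (fun A =>
      { hom := envLift (tensorUnit A)
        inv := tensorLift (envUnit A)
        hom_inv_id := env_hom_ext fun a =>
          (congrArg (tensorLift (envUnit A)).lin (envLift_unit (tensorUnit A) a)).trans
            (tensorLift_gen (envUnit A) a)
        inv_hom_id := tensor_hom_ext fun a =>
          (congrArg (envLift (tensorUnit A)).lin (tensorLift_gen (envUnit A) a)).trans
            (envLift_unit (tensorUnit A) a) })
    fun {A B} f => env_hom_ext fun a =>
      (congrArg (envLift (tensorUnit B)).lin (envLift_unit (f ≫ envUnit B) a)).trans <|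
        (envLift_unit (tensorUnit B) (f.lin a)).trans <|
          (tmap_gen f.lin a).symm.trans
            (congrArg (tmap f.lin) (envLift_unit (tensorUnit A) a)).symm

end BInfinity

theorem proposition3p2p1 (K : Type u) [Field K] :
    ∃ adj : BInfinity.tensorFunctor K ⊣ BInfinity.underlyingFunctor K,
      (∀ A : BInfinity.BInfAlg K, (adj.unit.app A).lin = BInfinity.gen K A.carrier) ∧
      (∀ V : BInfinity.TwoAsDGA K,
        (adj.counit.app V).lin =
          BInfinity.projTilde K V.carrier ∘ₗ BInfinity.twist V.deg) ∧
      ∃ e : BInfinity.envFunctor K ≅ BInfinity.tensorFunctor K,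
        ∀ (A : BInfinity.BInfAlg K) (a : A.carrier),
          (e.hom.app A).lin ((BInfinity.envUnit A).lin a) = BInfinity.gen K A.carrier a := by
  refine ⟨BInfinity.tensorAdjunction K, fun A => rfl, fun V => ?_,
    BInfinity.envIsoTensor K, fun A a => BInfinity.envLift_unit (BInfinity.tensorUnit A) a⟩
  exact (BInfinity.projTilde_twist V.deg).symm
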